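/- Throughout, $\|\cdot\|$ is the $\ell_2$ norm of vectors and the operator norm of matrices, and $\mathcal N(0,1)$ is the standard Gaussian law. For a $3$-tensor $\mathbf A=(a_{ijk})\in\mathbb R^{n\times n\times n}$ write $\mathbf A(x)=\sum_{i,j,k}a_{ijk}x_ix_jx_k$. A matrix $M\in\mathbb R^{n^2\times n^2}$ is a matrix representation of a quartic form $p$ if $p(x)=\langle x\otimes x, M(x\otimes x)\rangle$ as polynomials. A cubic form $f$ in $x=(x_1,\dots,x_n)$ is $\lambda$-bounded if there are $n\times n$ matrices $A_1,\dots,A_n$ with $f=\sum_i x_i\langle x,A_ix\rangle$ and a matrix representation $M$ of $\|x\|^4$ with $\sum_i A_i\otimes A_i\preceq\lambda^2 M$ (that is, the difference $\lambda^2M-\sum_iA_i\otimes A_i$ is symmetric positive semidefinite). A degree-$4$ pseudo-expectation is a linear functional $\tilde{\mathbb E}:\mathbb R[x]_{\le4}\to\mathbb R$ with $\tilde{\mathbb E}\,1=1$ and $\tilde{\mathbb E}\,s^2\ge0$ for every polynomial $s$ of degree at most $2$; it satisfies $\{\|x\|^2=1\}$ if $\tilde{\mathbb E}(\|x\|^2-1)q=0$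 for every polynomial $q$ of degree at most $2$. Degree-$4$ SoS certifies $\max_{\|v\|=1}f(v)\le c$ if there are finitely many polynomials $s_1,\dots,s_k$ and a polynomial $q$, all of degree at most $2$, with $c-f=\sum_{l} s_l^2+(\|x\|^2-1)q$; in particular $\tilde{\mathbb E}f\le c$ for every degree-$4$ pseudo-expectation satisfying $\{\|x\|^2=1\}$, and $f(v)\le c$ for every unit vector $v$ (these two consequences are part of the claim). **Theorem.** There are absolute constants $C,K>0$ such that the following hold for every integer $n\ge1$. 1. Let $c\in\{1,2\}$ and let $d\ge1$ be an integer. Let $A_1,\dots,A_{n^c}$ be independent random $n^d\times n^d$ matrices whose entries are all independent, and either all distributed as $\mathcal N(0,1)$ or all uniform on $\{\pm1\}$. Then, with probability at least $1-Kn^{-100}$, both $$\Big\|\sum_{i\in[n^c]}\big(A_i\otimes A_i-\mathbb E\,A_i\otimes A_i\big)\Big\|\le C\sqrt d\,n^{(2d+c)/2}(\log n)^{1/2}$$ and $$\Big\|\sum_{i\in[n^c]}\big(A_i\otimes A_i^{T}-\mathbb E\,A_i\otimes A_i^{T}\big)\Big\|\le C\sqrt d\,n^{(2d+c)/2}(\log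 n)^{1/2}.$$ 2. Let $\mathbf A$ be an $n\times n\times n$ tensor with independent $\mathcal N(0,1)$ entries. Then, with probability at least $1-Kn^{-10}$, the cubic form $\mathbf A(x)$ is $\lambda$-bounded with $\lambda=C\,n^{3/4}(\log n)^{1/4}$. 3. Let $\mathbf A$ be as in 2. Then, with probability at least $1-Kn^{-10}$, degree-$4$ SoS certifies that $\max_{\|v\|=1}\mathbf A(v)\le C\,n^{3/4}(\log n)^{1/4}$ and, furthermore, every degree-$4$ pseudo-expectation $\tilde{\mathbb E}$ satisfies $$\tilde{\mathbb E}\,\mathbf A(x)\le C\,n^{3/4}(\log n)^{1/4}\,\big(\tilde{\mathbb E}\,\|x\|^4\big)^{3/4}.$$ -/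

import Mathlib

open MeasureTheory ProbabilityTheory
open scoped Kronecker

namespace TensorSoS

noncomputable section

/-! ### Operator norm and expectation of random matrices -/

/-- The operator norm (`ℓ²` to `ℓ²`) of a square real matrix. -/
def opNorm {m : Type*} [Fintype m] [DecidableEq m] (M : Matrix m m ℝ) : ℝ :=
  ‖Matrix.toEuclideanCLM (n := m) (𝕜 := ℝ) M‖

/-- The entrywise expectation of a random matrix. -/
def expectMatrix {Ω m : Type*} [MeasurableSpace Ω] (P : Measure Ω)
    (M : Ω → Matrix m m ℝ) : Matrix m m ℝ :=
  Matrix.of fun a b => ∫ ω, M ω a b ∂P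

/-- The uniform distribution on `{1, -1}`. -/
def signLaw : Measure ℝ :=
  (2⁻¹ : ENNReal) • Measure.dirac 1 + (2⁻¹ : ENNReal) • Measure.dirac (-1)

/-- The value at `ω` of `∑ i, (A i ⊗ A i - E (A i ⊗ A i))`. -/
def kroneckerDeviation {Ω : Type*} [MeasurableSpace Ω] (P : Measure Ω) {k N : ℕ}
    (A : Fin k → Ω → Matrix (Fin N) (Fin N) ℝ) (ω : Ω) :
    Matrix (Fin N × Fin N) (Fin N × Fin N) ℝ :=
  ∑ i, (A i ω ⊗ₖ A i ω - expectMatrix P fun ω' => A i ω' ⊗ₖ A i ω')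

/-- The value at `ω` of `∑ i, (A i ⊗ (A i)ᵀ - E (A i ⊗ (A i)ᵀ))`. -/
def kroneckerTransposeDeviation {Ω : Type*} [MeasurableSpace Ω] (P : Measure Ω) {k N : ℕ}
    (A : Fin k → Ω → Matrix (Fin N) (Fin N) ℝ) (ω : Ω) :
    Matrix (Fin N × Fin N) (Fin N × Fin N) ℝ :=
  ∑ i, (A i ω ⊗ₖ (A i ω).transpose -
    expectMatrix P fun ω' => A i ω' ⊗ₖ (A i ω').transpose)

/-! ### Polynomials, matrix representations and boundedness -/

/-- The polynomial `‖x‖² = x₁² + ⋯ + xₙ²`. -/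
def normSqPoly (n : ℕ) : MvPolynomial (Fin n) ℝ :=
  ∑ i, MvPolynomial.X i ^ 2

/-- The quadratic form `⟨x, A x⟩` as a polynomial. -/
def quadPoly {n : ℕ} (A : Matrix (Fin n) (Fin n) ℝ) : MvPolynomial (Fin n) ℝ :=
  ∑ i, ∑ j, MvPolynomial.C (A i j) * (MvPolynomial.X i * MvPolynomial.X j)

/-- The cubic form `T(x) = ⟨x ⊗ x ⊗ x, T⟩` of a `3`-tensor, as a polynomial. -/
def tensorPoly {n : ℕ} (T : Fin n → Fin n → Fin n → ℝ) : MvPolynomial (Fin n) ℝ :=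
  ∑ i, ∑ j, ∑ k, MvPolynomial.C (T i j k) *
    (MvPolynomial.X i * MvPolynomial.X j * MvPolynomial.X k)

/-- `M` is a matrix representation of the quartic form `p`: `p = ⟨x ⊗ x, M (x ⊗ x)⟩`. -/
def IsMatrixRep {n : ℕ} (M : Matrix (Fin n × Fin n) (Fin n × Fin n) ℝ)
    (p : MvPolynomial (Fin n) ℝ) : Prop :=
  p = ∑ a : Fin n × Fin n, ∑ b : Fin n × Fin n, MvPolynomial.C (M a b) *
    ((MvPolynomial.X a.1 * MvPolynomial.X a.2) * (MvPolynomial.X b.1 * MvPolynomial.X b.2))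

/-- The cubic form `f` is `lam`-bounded: there are matrices `A₁, …, Aₙ` with
`f = ∑ xᵢ ⟨x, Aᵢ x⟩` and a matrix representation `M` of `‖x‖⁴` such that
`∑ Aᵢ ⊗ Aᵢ ≼ lam² M`.  The Loewner relation means that the difference is
symmetric and positive semidefinite. -/
def IsLambdaBounded {n : ℕ} (f : MvPolynomial (Fin n) ℝ) (lam : ℝ) : Prop :=
  ∃ (A : Fin n → Matrix (Fin n) (Fin n) ℝ) (M : Matrix (Fin n × Fin n) (Fin n × Fin n) ℝ),
    f = ∑ i, MvPolynomial.X i * quadPoly (A i) ∧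
    IsMatrixRep M (normSqPoly n ^ 2) ∧
    (lam ^ 2 • M - ∑ i, A i ⊗ₖ A i).PosSemidef

/-! ### Pseudo-expectations and sum-of-squares certificates -/

/-- The space of real polynomials in `n` variables of degree at most `d`. -/
abbrev PolyLE (n d : ℕ) : Submodule ℝ (MvPolynomial (Fin n) ℝ) :=
  MvPolynomial.restrictTotalDegree (Fin n) ℝ d

/-- A degree-`d` pseudo-expectation (`d` even): a linear functional on polynomials of degree
at most `d` with `L 1 = 1` and `L (s²) ≥ 0` for all `s` of degree at most `d / 2`. -/
structure IsPseudoExpectation {n d : ℕ} (L : PolyLE n d →ₗ[ℝ] ℝ) : Prop where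
  map_one : ∀ p : PolyLE n d, (p : MvPolynomial (Fin n) ℝ) = 1 → L p = 1
  map_sq_nonneg : ∀ (p : PolyLE n d) (s : MvPolynomial (Fin n) ℝ),
    s.totalDegree ≤ d / 2 → (p : MvPolynomial (Fin n) ℝ) = s ^ 2 → 0 ≤ L p

/-- The functional `L` satisfies the constraint `g = 0`: it vanishes on every multiple of `g`
of degree at most `d`. -/
def SatisfiesEq {n d : ℕ} (L : PolyLE n d →ₗ[ℝ] ℝ) (g : MvPolynomial (Fin n) ℝ) : Prop :=
  ∀ (p : PolyLE n d) (q : MvPolynomial (Fin n) ℝ),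
    (p : MvPolynomial (Fin n) ℝ) = g * q → L p = 0

/-- A degree-`4` sum-of-squares certificate of the bound `f ≤ c` on the unit sphere:
`c - f = s₁² + ⋯ + s_k² + (‖x‖² - 1) q` with all terms of degree at most `4`. -/
def HasSoSCertificate {n : ℕ} (f : MvPolynomial (Fin n) ℝ) (c : ℝ) : Prop :=
  ∃ (k : ℕ) (s : Fin k → MvPolynomial (Fin n) ℝ) (q : MvPolynomial (Fin n) ℝ),
    (∀ i, (s i).totalDegree ≤ 2) ∧ q.totalDegree ≤ 2 ∧
    MvPolynomial.C c - f = ∑ i, s i ^ 2 + (normSqPoly n - 1) * q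

theorem totalDegree_normSqPoly_le (n : ℕ) : (normSqPoly n).totalDegree ≤ 2 := by
  refine MvPolynomial.totalDegree_finsetSum_le fun i _ => ?_
  exact (MvPolynomial.totalDegree_pow _ _).trans (by simp)

theorem totalDegree_tensorPoly_le {n : ℕ} (T : Fin n → Fin n → Fin n → ℝ) :
    (tensorPoly T).totalDegree ≤ 3 := by
  refine MvPolynomial.totalDegree_finsetSum_le fun i _ => ?_
  refine MvPolynomial.totalDegree_finsetSum_le fun j _ => ?_
  refine MvPolynomial.totalDegree_finsetSum_le fun k _ => ?_
  refine (MvPolynomial.totalDegree_mul _ _).trans ?_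
  have h1 := MvPolynomial.totalDegree_mul
    (MvPolynomial.X i * MvPolynomial.X j : MvPolynomial (Fin n) ℝ) (MvPolynomial.X k)
  have h2 := MvPolynomial.totalDegree_mul
    (MvPolynomial.X i : MvPolynomial (Fin n) ℝ) (MvPolynomial.X j)
  simp only [MvPolynomial.totalDegree_X, MvPolynomial.totalDegree_C] at *
  omega

/-- `T(x)` as an element of the space of polynomials of degree at most `4`. -/
def tensorLE {n : ℕ} (T : Fin n → Fin n → Fin n → ℝ) : PolyLE n 4 :=
  ⟨tensorPoly T, (MvPolynomial.mem_restrictTotalDegree _ _ _).2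
    ((totalDegree_tensorPoly_le T).trans (by norm_num))⟩

/-- `‖x‖⁴` as an element of the space of polynomials of degree at most `4`. -/
def normFourLE (n : ℕ) : PolyLE n 4 :=
  ⟨normSqPoly n ^ 2, (MvPolynomial.mem_restrictTotalDegree _ _ _).2
    ((MvPolynomial.totalDegree_pow _ _).trans
      (by have := totalDegree_normSqPoly_le n; omega))⟩

/-- The degree-`4` SoS algorithm certifies `max_{‖v‖ = 1} T(v) ≤ c`: there is a degree-`4`
sum-of-squares certificate, the value of the relaxation over degree-`4` pseudo-expectations
satisfying `‖x‖² = 1` is at most `c`, and the certified bound holds. -/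
structure SoSCertifies {n : ℕ} (T : Fin n → Fin n → Fin n → ℝ) (c : ℝ) : Prop where
  certificate : HasSoSCertificate (tensorPoly T) c
  relaxation : ∀ L : PolyLE n 4 →ₗ[ℝ] ℝ, IsPseudoExpectation L →
    SatisfiesEq L (normSqPoly n - 1) → L (tensorLE T) ≤ c
  bound : ∀ v : EuclideanSpace ℝ (Fin n), ‖v‖ = 1 →
    MvPolynomial.eval (fun i => v i) (tensorPoly T) ≤ c

/-! ### The Gaussian tensor model -/

/-- `A` is a random `3`-tensor with independent standard Gaussian entries. -/
structure IsGaussianTensor {Ω : Type*} [MeasurableSpace Ω] (P : Measure Ω) {n : ℕ}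
    (A : Fin n → Fin n → Fin n → Ω → ℝ) : Prop where
  law : ∀ i j k, HasLaw (A i j k) (gaussianReal 0 1) P
  indep : iIndepFun (fun (t : Fin n × Fin n × Fin n) => A t.1 t.2.1 t.2.2) P

end

end TensorSoS

open TensorSoS

/-! Let `N` be the size of the matrices and `k` their number. A matrix with independent sub-Gaussian
entries has norm `O(√N)`, so each `Aᵢ ⊗ Aᵢ` has norm `O(N)`, and the centred sum should have norm
about `N √k`, times `√(log N)` for the dimension.

Centring is traded for random signs (`lintegral_enorm_sum_sub_integral_pow_le`). With the matrices
frozen, put `S = ∑ εᵢ Bᵢ` and expand `(Sᵀ S) ^ p`. Every monomial in the signs has nonnegative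
average, so the triangle inequality and submultiplicativity replace each `Bᵢ` by its norm
(`norm_sum_pow_le`). Only scalar Rademacher moments remain, with variance `∑ ‖Bᵢ‖²`; replacing `‖∑
Bᵢᵀ Bᵢ‖` by this sum costs nothing here, since the target is `√k · max ‖Bᵢ‖`. As `‖Bᵢ‖ ≤ ‖Aᵢ‖²`,
moments of `‖Aᵢ‖` finish the estimate; these come from a net and an exponential moment
(`lintegral_norm_pow_le`). Taking `p` of order `log N` makes the dimension factor harmless in
Markov's inequality.

For the cubic form, `E (Aᵢ ⊗ Aᵢ) = vec(I) vec(I)ᵀ`. The sum of these means has norm `n²`, far too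
large, but `vec(I) vec(I)ᵀ` itself represents `‖x‖⁴`, so it can be absorbed into `M`. Only the
deviation, of norm `O(n^(3/2) √(log n))`, has to be dominated by the identity
(`isLambdaBounded_of_norm_sub_le`).

Boundedness yields the certificates by Cauchy–Schwarz and AM–GM written as sums of squares
(`IsLambdaBounded.exists_sum_sq`), with a free scale `r` chosen at the end. -/

namespace TensorSoS
open scoped Matrix.Norms.L2Operator

/-! ### Moments of signed sums in a normed algebra -/

section SignAverages

/-- The sign attached to a Boolean. -/
def boolSign (b : Bool) : ℝ := cond b 1 (-1)

variable {ι : Type*} [Fintype ι]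

/-- The signed monomial `∏ εᵢ ^ mᵢ`. -/
def signMonomial (m : ι → ℕ) (ε : ι → Bool) : ℝ := ∏ i, boolSign (ε i) ^ m i

/-- The sum factors over the coordinates; each factor is `2` for an even exponent and `0` for an odd
one. -/
theorem sum_signMonomial_nonneg [DecidableEq ι] (m : ι → ℕ) :
    0 ≤ ∑ ε : ι → Bool, signMonomial m ε := by
  have h := Finset.prod_univ_sum (fun _ : ι => (Finset.univ : Finset Bool))
    (fun i b => boolSign b ^ m i)
  rw [Fintype.piFinset_univ] at h
  simp only [signMonomial]
  rw [← h]
  refine Finset.prod_nonneg fun i _ => ?_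
  rcases neg_one_pow_eq_or ℝ (m i) with h | h <;> simp [boolSign, h]

theorem signMonomial_add_single [DecidableEq ι] (m : ι → ℕ) (i : ι) (ε : ι → Bool) :
    signMonomial (m + Pi.single i 1) ε = signMonomial m ε * boolSign (ε i) := by
  simp only [signMonomial, Pi.add_apply, pow_add, Finset.prod_mul_distrib]
  congr 1
  rw [Finset.prod_eq_single i] <;> simp +contextual

variable {R : Type*} [NormedRing R] [NormedAlgebra ℝ R]

/-- Every signed moment of `G` is dominated by the corresponding moment of `g`. -/
def SignMajorized [DecidableEq ι] (G : (ι → Bool) → R) (g : (ι → Bool) → ℝ) : Prop :=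
  ∀ m : ι → ℕ, ‖∑ ε, signMonomial m ε • G ε‖ ≤ ∑ ε, signMonomial m ε * g ε

variable [DecidableEq ι]

theorem signMajorized_one (h1 : ‖(1 : R)‖ ≤ 1) :
    SignMajorized (fun _ : ι → Bool => (1 : R)) (fun _ => 1) := by
  intro m
  rw [← Finset.sum_smul, norm_smul, Real.norm_of_nonneg (sum_signMonomial_nonneg m)]
  simpa using mul_le_mul_of_nonneg_left h1 (sum_signMonomial_nonneg m)

/-- Multiplying by `∑ εᵢ Bᵢ` shifts the exponent `m` to `m + eᵢ`. This is why `SignMajorized` asks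
for all signed moments and not just the plain one: the property then survives induction on the
number of factors. -/
theorem SignMajorized.sum_smul_mul {G : (ι → Bool) → R} {g : (ι → Bool) → ℝ}
    (h : SignMajorized G g) {B : ι → R} {b : ι → ℝ} (hB : ∀ i, ‖B i‖ ≤ b i) :
    SignMajorized (fun ε => (∑ i, boolSign (ε i) • B i) * G ε)
      (fun ε => (∑ i, boolSign (ε i) * b i) * g ε) := by
  intro m
  have h1 : ∑ ε, signMonomial m ε • ((∑ i, boolSign (ε i) • B i) * G ε) =
      ∑ i, B i * ∑ ε, signMonomial (m + Pi.single i 1) ε • G ε := by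
    simp only [Finset.sum_mul, Finset.smul_sum, Finset.mul_sum]
    rw [Finset.sum_comm]
    refine Finset.sum_congr rfl fun i _ => Finset.sum_congr rfl fun ε _ => ?_
    rw [signMonomial_add_single, smul_mul_assoc, mul_smul_comm, smul_smul]
  have h2 : ∑ ε, signMonomial m ε * ((∑ i, boolSign (ε i) * b i) * g ε) =
      ∑ i, b i * ∑ ε, signMonomial (m + Pi.single i 1) ε * g ε := by
    simp only [Finset.sum_mul, Finset.mul_sum]
    rw [Finset.sum_comm]
    refine Finset.sum_congr rfl fun i _ => Finset.sum_congr rfl fun ε _ => ?_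
    rw [signMonomial_add_single]; ring
  rw [h1, h2]
  refine (norm_sum_le _ _).trans (Finset.sum_le_sum fun i _ => ?_)
  exact (norm_mul_le _ _).trans
    (mul_le_mul (hB i) (h _) (norm_nonneg _) ((norm_nonneg _).trans (hB i)))

theorem signMajorized_pow (h1 : ‖(1 : R)‖ ≤ 1) {B D : ι → R} {b : ι → ℝ}
    (hB : ∀ i, ‖B i‖ ≤ b i) (hD : ∀ i, ‖D i‖ ≤ b i) (p : ℕ) :
    SignMajorized (fun ε => ((∑ i, boolSign (ε i) • D i) * ∑ i, boolSign (ε i) • B i) ^ p)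
      (fun ε => (∑ i, boolSign (ε i) * b i) ^ (2 * p)) := by
  induction p with
  | zero => simpa using signMajorized_one (ι := ι) h1
  | succ p ih =>
    have := (ih.sum_smul_mul hB).sum_smul_mul hD
    convert this using 2 with ε ε
    · rw [pow_succ', mul_assoc]
    · ring

theorem norm_sum_pow_le (h1 : ‖(1 : R)‖ ≤ 1) {B D : ι → R} {b : ι → ℝ}
    (hB : ∀ i, ‖B i‖ ≤ b i) (hD : ∀ i, ‖D i‖ ≤ b i) (p : ℕ) :
    ‖∑ ε : ι → Bool, ((∑ i, boolSign (ε i) • D i) * ∑ i, boolSign (ε i) • B i) ^ p‖ ≤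
      ∑ ε : ι → Bool, (∑ i, boolSign (ε i) * b i) ^ (2 * p) := by
  simpa [signMonomial] using signMajorized_pow h1 hB hD p 0

/-- The sum factors into terms `2 cosh bᵢ`, and `cosh b ≤ exp (b² / 2)`. -/
theorem sum_exp_sign_le (b : ι → ℝ) :
    ∑ ε : ι → Bool, Real.exp (∑ i, boolSign (ε i) * b i) ≤
      2 ^ Fintype.card ι * Real.exp ((∑ i, b i ^ 2) / 2) := by
  have h := Finset.prod_univ_sum (fun _ : ι => (Finset.univ : Finset Bool))
    (fun i s => Real.exp (boolSign s * b i))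
  rw [Fintype.piFinset_univ] at h
  simp only [Real.exp_sum]
  rw [← h, Finset.sum_div, Real.exp_sum]
  have h2 : (2 : ℝ) ^ Fintype.card ι = ∏ _i : ι, (2 : ℝ) := by simp
  rw [h2, ← Finset.prod_mul_distrib]
  refine Finset.prod_le_prod (fun i _ => by positivity) fun i _ => ?_
  have := Real.cosh_le_exp_half_sq (b i)
  rw [Real.cosh_eq] at this
  simp [boolSign]
  linarith

/-- Khintchine's inequality with constant of order `p`, read off from the exponential moment through
`y ^ (2p) ≤ (2p)! exp |y|`. -/
theorem sum_pow_sign_le (b : ι → ℝ) {p : ℕ} (hp : p ≠ 0) :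
    ∑ ε : ι → Bool, (∑ i, boolSign (ε i) * b i) ^ (2 * p) ≤
      2 ^ Fintype.card ι * (2 * (2 * p * Real.exp 1 * ∑ i, b i ^ 2) ^ p) := by
  set v : ℝ := ∑ i, b i ^ 2 with hv
  have hv0 : 0 ≤ v := Finset.sum_nonneg fun i _ => sq_nonneg _
  rcases hv0.eq_or_lt with h0 | hpos
  · have hb : ∀ i, b i = 0 := fun i => by
      have := (Finset.sum_eq_zero_iff_of_nonneg fun i _ => sq_nonneg (b i)).1 (hv ▸ h0.symm) i
        (Finset.mem_univ i)
      simpa using this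
    simp [hb, ← h0, hp]
  -- This `t` minimises `exp (t² v / 2) / t ^ (2p)`; the exponent `t² v / 2` becomes `p`.
  set t : ℝ := √(2 * p / v) with ht
  have hp' : (0 : ℝ) < p := by positivity
  have htpos : 0 < t := Real.sqrt_pos.2 (by positivity)
  have ht2 : t ^ 2 = 2 * p / v := Real.sq_sqrt (by positivity)
  have hpt : ∀ x : ℝ, t ^ (2 * p) * x ^ (2 * p) ≤
      (2 * p).factorial * (Real.exp (t * x) + Real.exp (-(t * x))) := by
    intro x
    have h1 := Real.pow_div_factorial_le_exp |t * x| (abs_nonneg _) (2 * p)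
    rw [div_le_iff₀ (by positivity), pow_mul, sq_abs, ← pow_mul, mul_pow] at h1
    have h2 := Real.exp_abs_le (t * x)
    have h3 : (0 : ℝ) < (2 * p).factorial := by positivity
    nlinarith
  have hsum : t ^ (2 * p) * ∑ ε : ι → Bool, (∑ i, boolSign (ε i) * b i) ^ (2 * p) ≤
      (2 * p).factorial * (2 * (2 ^ Fintype.card ι * Real.exp p)) := by
    rw [Finset.mul_sum]
    refine (Finset.sum_le_sum fun ε _ => hpt _).trans ?_
    rw [← Finset.mul_sum, Finset.sum_add_distrib]
    gcongr
    have e1 := sum_exp_sign_le fun i => t * b i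
    have e2 := sum_exp_sign_le fun i => -(t * b i)
    have e3 : (∑ i, (t * b i) ^ 2) / 2 = p := by
      simp only [mul_pow, ← Finset.mul_sum, ← hv, ht2]
      field_simp
    have e4 : (∑ i, (-(t * b i)) ^ 2) / 2 = p := by simpa using e3
    rw [e3] at e1
    rw [e4] at e2
    simp only [mul_neg, Finset.sum_neg_distrib, mul_left_comm _ t, ← Finset.mul_sum] at e1 e2
    linarith
  have hfac : ((2 * p).factorial : ℝ) ≤ (2 * p : ℝ) ^ (2 * p) := by
    exact_mod_cast Nat.factorial_le_pow (2 * p)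
  have htp : t ^ (2 * p) = (2 * p / v) ^ p := by rw [pow_mul, ht2]
  rw [htp] at hsum
  have hexp : Real.exp (p : ℝ) = Real.exp 1 ^ p := by rw [← Real.exp_nat_mul, mul_one]
  have hq : (0 : ℝ) < (2 * p / v) ^ p := by positivity
  refine le_of_mul_le_mul_left (hsum.trans ?_) hq
  rw [hexp]
  calc ((2 * p).factorial : ℝ) * (2 * (2 ^ Fintype.card ι * Real.exp 1 ^ p))
      ≤ (2 * p : ℝ) ^ (2 * p) * (2 * (2 ^ Fintype.card ι * Real.exp 1 ^ p)) := by gcongr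
    _ = (2 * p / v) ^ p *
          (2 ^ Fintype.card ι * (2 * (2 * p * Real.exp 1 * v) ^ p)) := by
      have : (2 * p / v : ℝ) ^ p * (2 * p * Real.exp 1 * v) ^ p =
          (2 * p : ℝ) ^ (2 * p) * Real.exp 1 ^ p := by
        rw [← mul_pow, pow_mul, ← mul_pow]
        congr 1
        field_simp
      linear_combination (-(2 ^ Fintype.card ι * 2) : ℝ) * this

end SignAverages

/-! ### Operator norms, traces and Kronecker products -/

section MatrixNorms

theorem norm_matrix_le_of_sq {m n : Type*} [Fintype m] [Fintype n] [DecidableEq n] (M : Matrix m n ℝ) {c : ℝ}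
    (hc : 0 ≤ c) (h : ∀ x : n → ℝ, ∑ i, (M.mulVec x i) ^ 2 ≤ c ^ 2 * ∑ j, x j ^ 2) : ‖M‖ ≤ c := by
  rw [Matrix.l2_opNorm_def]
  refine ContinuousLinearMap.opNorm_le_bound _ hc fun x => ?_
  rw [EuclideanSpace.norm_eq, EuclideanSpace.norm_eq, ← Real.sqrt_sq hc,
    ← Real.sqrt_mul (sq_nonneg c)]
  refine Real.sqrt_le_sqrt ?_
  simpa using h x.ofLp

theorem sum_sq_mulVec_le {m n : Type*} [Fintype m] [Fintype n] [DecidableEq n] (M : Matrix m n ℝ) (x : n → ℝ) :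
    ∑ i, (M.mulVec x i) ^ 2 ≤ ‖M‖ ^ 2 * ∑ j, x j ^ 2 := by
  have := Matrix.l2_opNorm_mulVec M (WithLp.toLp 2 x)
  have h := pow_le_pow_left₀ (norm_nonneg _) this 2
  rw [mul_pow, EuclideanSpace.norm_sq_eq, EuclideanSpace.norm_sq_eq] at h
  simpa using h

variable {m : Type*} [Fintype m] [DecidableEq m]

theorem opNorm_eq_norm (M : Matrix m m ℝ) : opNorm M = ‖M‖ := rfl

theorem norm_transpose_matrix (M : Matrix m m ℝ) : ‖M.transpose‖ = ‖M‖ := by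
  rw [← Matrix.conjTranspose_eq_transpose_of_trivial, Matrix.l2_opNorm_conjTranspose]

theorem norm_one_matrix_le : ‖(1 : Matrix m m ℝ)‖ ≤ 1 := by
  rw [Matrix.cstar_norm_def, map_one]
  exact ContinuousLinearMap.norm_id_le

/-- The right side is the squared Frobenius norm. -/
theorem norm_sq_le_trace (S : Matrix m m ℝ) : ‖S‖ ^ 2 ≤ (S.transpose * S).trace := by
  have h0 : (S.transpose * S).trace = ∑ i, ∑ j, S i j ^ 2 := by
    simp only [Matrix.trace, Matrix.diag, Matrix.mul_apply, Matrix.transpose_apply]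
    rw [Finset.sum_comm]
    simp only [sq]
  have hn : 0 ≤ ∑ i, ∑ j, S i j ^ 2 := by positivity
  rw [h0]
  have := norm_matrix_le_of_sq S (Real.sqrt_nonneg (∑ i, ∑ j, S i j ^ 2)) fun x => by
    rw [Real.sq_sqrt hn, Finset.sum_mul]
    exact Finset.sum_le_sum fun i _ => Finset.sum_mul_sq_le_sq_mul_sq _ _ _
  calc ‖S‖ ^ 2 ≤ _ := pow_le_pow_left₀ (norm_nonneg _) this 2
    _ = _ := Real.sq_sqrt hn

theorem trace_le_card_mul_norm (S : Matrix m m ℝ) : S.trace ≤ Fintype.card m * ‖S‖ := by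
  have h : ∀ i, S i i ≤ ‖S‖ := fun i => by
    have h1 := sum_sq_mulVec_le S (Pi.single i 1)
    have h2 : (S.mulVec (Pi.single i 1) i) ^ 2 ≤ ∑ j, (S.mulVec (Pi.single i 1) j) ^ 2 :=
      Finset.single_le_sum (f := fun j => (S.mulVec (Pi.single i 1) j) ^ 2)
        (fun j _ => sq_nonneg _) (Finset.mem_univ i)
    have h3 : ∑ j, (Pi.single i (1 : ℝ) : m → ℝ) j ^ 2 = 1 := by
      rw [Finset.sum_eq_single i] <;> simp +contextual
    rw [h3, mul_one] at h1
    have h4 := abs_le_of_sq_le_sq (h2.trans h1) (norm_nonneg _)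
    simp only [Matrix.mulVec_single_one, Matrix.col_apply] at h4
    exact (le_abs_self _).trans h4
  calc S.trace = ∑ i, S i i := rfl
    _ ≤ ∑ _i : m, ‖S‖ := Finset.sum_le_sum fun i _ => h i
    _ = _ := by simp

/-- The Frobenius bound is applied to `(Sᵀ S) ^ 2 ^ j`, which is symmetric, so that its norm is `‖S‖
^ (2 * 2 ^ j)`. Powers of two come from iterating the C⋆-identity. -/
theorem norm_pow_le_trace (S : Matrix m m ℝ) (j : ℕ) :
    ‖S‖ ^ (2 * 2 ^ (j + 1)) ≤ ((S.transpose * S) ^ 2 ^ (j + 1)).trace := by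
  have hsa : IsSelfAdjoint (S.transpose * S) := by
    rw [← Matrix.conjTranspose_eq_transpose_of_trivial]
    exact IsSelfAdjoint.star_mul_self S
  have hT : ((S.transpose * S) ^ 2 ^ j).transpose = (S.transpose * S) ^ 2 ^ j := by
    rw [Matrix.transpose_pow, Matrix.transpose_mul, Matrix.transpose_transpose]
  have h2 := norm_sq_le_trace ((S.transpose * S) ^ 2 ^ j)
  rw [hT, ← pow_add, ← two_mul, ← pow_succ', hsa.norm_pow_two_pow, ← pow_mul, ← pow_succ] at h2
  have h3 : ‖S.transpose * S‖ = ‖S‖ ^ 2 := by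
    rw [← Matrix.conjTranspose_eq_transpose_of_trivial, Matrix.l2_opNorm_conjTranspose_mul_self, sq]
  rw [h3, ← pow_mul] at h2
  exact h2

/-- Passing to the trace makes the sum over signs linear, so the cancellation takes place inside the
matrix before a norm is taken; the trace costs one dimension factor. -/
theorem sum_norm_pow_sign_le {ι : Type*} [Fintype ι] [DecidableEq ι] (B : ι → Matrix m m ℝ)
    (j : ℕ) :
    ∑ ε : ι → Bool, ‖∑ i, boolSign (ε i) • B i‖ ^ (2 * 2 ^ (j + 1)) ≤
      Fintype.card m * (2 ^ Fintype.card ι *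
        (2 * (2 * (2 ^ (j + 1) : ℕ) * Real.exp 1 * ∑ i, ‖B i‖ ^ 2) ^ 2 ^ (j + 1))) := by
  have h1 := norm_sum_pow_le (B := B) (D := fun i => (B i).transpose) norm_one_matrix_le
    (fun i => le_rfl) (fun i => (norm_transpose_matrix (B i)).le) (2 ^ (j + 1))
  refine (Finset.sum_le_sum fun ε _ => norm_pow_le_trace _ j).trans ?_
  rw [← Matrix.trace_sum]
  refine (trace_le_card_mul_norm _).trans ?_
  refine mul_le_mul_of_nonneg_left ?_ (Nat.cast_nonneg _)
  simp only [Matrix.transpose_sum, Matrix.transpose_smul]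
  exact h1.trans (sum_pow_sign_le _ (by positivity))

/-- The product acts by `B` on the second index and then by `A` on the first, each with the other
index frozen. -/
theorem norm_kronecker_le {n : Type*} [Fintype n] [DecidableEq n] (A : Matrix m m ℝ)
    (B : Matrix n n ℝ) : ‖A ⊗ₖ B‖ ≤ ‖A‖ * ‖B‖ := by
  refine norm_matrix_le_of_sq _ (by positivity) fun x => ?_
  have h1 : ∀ i k, (A ⊗ₖ B).mulVec x (i, k) =
      A.mulVec (fun j => B.mulVec (fun l => x (j, l)) k) i := by
    intro i k
    simp only [Matrix.mulVec, dotProduct, Matrix.kroneckerMap_apply, Fintype.sum_prod_type,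
      Finset.mul_sum, mul_assoc]
  rw [Fintype.sum_prod_type, Finset.sum_comm]
  simp only [h1]
  calc _ ≤ ∑ k, ‖A‖ ^ 2 * ∑ j, (B.mulVec (fun l => x (j, l)) k) ^ 2 :=
        Finset.sum_le_sum fun k _ => sum_sq_mulVec_le A _
    _ = ‖A‖ ^ 2 * ∑ j, ∑ k, (B.mulVec (fun l => x (j, l)) k) ^ 2 := by
        rw [← Finset.mul_sum, Finset.sum_comm]
    _ ≤ ‖A‖ ^ 2 * ∑ j, ‖B‖ ^ 2 * ∑ l, x (j, l) ^ 2 := by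
        gcongr with j
        exact sum_sq_mulVec_le B _
    _ = _ := by rw [← Finset.mul_sum, Fintype.sum_prod_type, mul_pow, mul_assoc]

end MatrixNorms

/-! ### Nets and the operator norm -/

section Net

/-- The ball of radius `2` has a `1`-net of at most `5 ^ dim` points of the ball. -/
theorem exists_net_closedBall_two (V : Type*) [NormedAddCommGroup V] [NormedSpace ℝ V]
    [FiniteDimensional ℝ V] :
    ∃ s : Finset V, s.card ≤ 5 ^ Module.finrank ℝ V ∧ (∀ c ∈ s, ‖c‖ ≤ 2) ∧
      ∀ x : V, ‖x‖ ≤ 2 → ∃ c ∈ s, ‖x - c‖ ≤ 1 := by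
  classical
  -- Separated subsets of the ball have bounded cardinality; one of largest size is a net, since an
  -- uncovered point could be added to it.
  set cards : Set ℕ := {N | ∃ s : Finset V, s.card = N ∧ (∀ c ∈ s, ‖c‖ ≤ 2) ∧
    ∀ c ∈ s, ∀ d ∈ s, c ≠ d → 1 ≤ ‖c - d‖} with hcards
  have hbdd : BddAbove cards := ⟨5 ^ Module.finrank ℝ V, by
    rintro N ⟨s, rfl, h1, h2⟩
    exact Besicovitch.card_le_of_separated s h1 h2⟩
  obtain ⟨s, hs, h1, h2⟩ := Nat.sSup_mem (s := cards) ⟨0, ∅, by simp⟩ hbdd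
  refine ⟨s, Besicovitch.card_le_of_separated s h1 h2, h1, fun x hx => ?_⟩
  by_contra! hcon
  have hxs : x ∉ s := fun h => by
    have := hcon x h
    norm_num at this
  have hmem : s.card + 1 ∈ cards := by
    refine ⟨insert x s, Finset.card_insert_of_notMem hxs, ?_, ?_⟩
    · intro c hc
      rcases Finset.mem_insert.1 hc with rfl | hc
      exacts [hx, h1 c hc]
    · intro c hc d hd hcd
      rcases Finset.mem_insert.1 hc with rfl | hc' <;> rcases Finset.mem_insert.1 hd with rfl | hd'
      · exact absurd rfl hcd
      · exact (hcon d hd').le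
      · rw [norm_sub_rev]; exact (hcon c hc').le
      · exact h2 c hc' d hd' hcd
  have := le_csSup hbdd hmem
  omega

/-- Radius `2` with mesh `1` loses no constant: approximating twice a unit vector up to error `1`
still leaves a full unit in its direction. -/
theorem exists_net_norm_le {V : Type*} [NormedAddCommGroup V] [InnerProductSpace ℝ V]
    (s : Finset V) (hs : ∀ x : V, ‖x‖ ≤ 2 → ∃ c ∈ s, ‖x - c‖ ≤ 1) (A : V →L[ℝ] V) :
    ∃ c ∈ s, ∃ d ∈ s, ‖A‖ ≤ inner ℝ d (A c) := by
  have hne : s.Nonempty := by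
    obtain ⟨c, hc, -⟩ := hs 0 (by simp)
    exact ⟨c, hc⟩
  have hvec : ∀ w : V, ∃ d ∈ s, ‖w‖ ≤ inner ℝ d w := by
    intro w
    rcases eq_or_ne w 0 with rfl | hw
    · obtain ⟨d, hd⟩ := hne
      exact ⟨d, hd, by simp⟩
    have hw' : ‖w‖ ≠ 0 := norm_ne_zero_iff.2 hw
    obtain ⟨d, hd, hdist⟩ := hs ((2 / ‖w‖) • w) (by
      rw [norm_smul, Real.norm_of_nonneg (by positivity), div_mul_cancel₀ _ hw'])
    refine ⟨d, hd, ?_⟩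
    have h1 : inner ℝ ((2 / ‖w‖) • w) w = 2 * ‖w‖ := by
      rw [real_inner_smul_left, real_inner_self_eq_norm_sq]
      field_simp
    have h2 : inner ℝ ((2 / ‖w‖) • w - d) w ≤ ‖w‖ :=
      (real_inner_le_norm _ _).trans (by nlinarith [norm_nonneg w])
    rw [inner_sub_left, h1] at h2
    linarith
  obtain ⟨c, hc, hmax⟩ := s.exists_max_image (fun c => ‖A c‖) hne
  obtain ⟨d, hd, hcd⟩ := hvec (A c)
  refine ⟨c, hc, d, hd, le_trans ?_ hcd⟩
  -- Self-bounding: the approximation error is again controlled by `‖A‖`, and solving gives `‖A‖ ≤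
  -- ‖A c‖`.
  have hle : ‖A‖ ≤ (‖A c‖ + ‖A‖) / 2 := by
    refine ContinuousLinearMap.opNorm_le_of_unit_norm (by positivity) fun x hx => ?_
    obtain ⟨c', hc', hdist⟩ := hs ((2 : ℝ) • x) (by rw [norm_smul, hx]; simp)
    have h1 : (2 : ℝ) • A x = A c' + A ((2 : ℝ) • x - c') := by
      rw [← map_smul, ← map_add]; congr 1; abel
    have h2 : 2 * ‖A x‖ ≤ ‖A c'‖ + ‖A‖ := by
      calc 2 * ‖A x‖ = ‖(2 : ℝ) • A x‖ := by rw [norm_smul]; simp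
        _ ≤ ‖A c'‖ + ‖A ((2 : ℝ) • x - c')‖ := by rw [h1]; exact norm_add_le _ _
        _ ≤ _ := by
          gcongr
          exact (A.le_opNorm _).trans (by nlinarith [norm_nonneg A])
    linarith [hmax c' hc']
  linarith

end Net

/-! ### Moments of the norm of a sub-Gaussian matrix -/

section ExponentialMoment

variable {Ω : Type*} [MeasurableSpace Ω] {P : Measure Ω}
  {m : Type*} [Fintype m] [DecidableEq m]

theorem lintegral_exp_sum_mul_le {τ : Type*} [Fintype τ] {X : τ → Ω → ℝ} (hind : iIndepFun X P)
    (hsub : ∀ t, HasSubgaussianMGF (X t) 1 P) (w : τ → ℝ) :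
    ∫⁻ ω, ENNReal.ofReal (Real.exp (∑ t, w t * X t ω)) ∂P ≤
      ENNReal.ofReal (Real.exp ((∑ t, w t ^ 2) / 2)) := by
  have h := HasSubgaussianMGF.sum_of_iIndepFun (X := fun t ω => w t * X t ω)
    (c := fun t => ⟨w t ^ 2, sq_nonneg _⟩ * 1) (s := Finset.univ)
    (hind.comp (fun t x => w t * x) fun t => measurable_const_mul _)
    (fun t _ => (hsub t).const_mul (w t))
  have hi := h.integrable_exp_mul 1
  have hm := h.mgf_le 1
  have hc : ((∑ t, (⟨w t ^ 2, sq_nonneg _⟩ * 1 : NNReal) : NNReal) : ℝ) = ∑ t, w t ^ 2 := by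
    rw [NNReal.coe_sum]
    exact Finset.sum_congr rfl fun t _ => mul_one _
  rw [hc] at hm
  simp only [one_mul, mgf, one_pow, mul_one] at hi hm
  rw [← ofReal_integral_eq_lintegral_ofReal hi (ae_of_all _ fun _ => (Real.exp_pos _).le)]
  exact ENNReal.ofReal_le_ofReal hm

/-- Union bound over the at most `5 ^ N * 5 ^ N` pairs of net points. Each bilinear form has
variance proxy `l² ‖d‖² ‖c‖² ≤ 16 l²`, and half of this is the exponent. -/
theorem lintegral_exp_norm_le (A : Ω → Matrix m m ℝ)
    (hind : iIndepFun (fun (t : m × m) ω => A ω t.1 t.2) P)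
    (hsub : ∀ t : m × m, HasSubgaussianMGF (fun ω => A ω t.1 t.2) 1 P) {l : ℝ} (hl : 0 ≤ l) :
    ∫⁻ ω, ENNReal.ofReal (Real.exp (l * ‖A ω‖)) ∂P ≤
      ENNReal.ofReal (25 ^ Fintype.card m * Real.exp (8 * l ^ 2)) := by
  obtain ⟨s, hcard, hs2, hnet⟩ := exists_net_closedBall_two (EuclideanSpace ℝ m)
  rw [finrank_euclideanSpace] at hcard
  have hinner : ∀ (ω : Ω) (c d : EuclideanSpace ℝ m),
      inner ℝ d (Matrix.toEuclideanCLM (n := m) (𝕜 := ℝ) (A ω) c) =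
        ∑ t : m × m, (d t.1 * c t.2) * A ω t.1 t.2 := by
    intro ω c d
    rw [PiLp.inner_apply, Fintype.sum_prod_type]
    refine Finset.sum_congr rfl fun i _ => ?_
    rw [Matrix.ofLp_toEuclideanCLM, Matrix.mulVec, dotProduct]
    simp only [RCLike.inner_apply, conj_trivial, Finset.sum_mul]
    exact Finset.sum_congr rfl fun j _ => by ring
  have hsingle : ∀ (f : EuclideanSpace ℝ m → EuclideanSpace ℝ m → ENNReal), ∀ c ∈ s, ∀ d ∈ s,
      f c d ≤ ∑ c ∈ s, ∑ d ∈ s, f c d := fun f c hc d hd =>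
    (Finset.single_le_sum_of_canonicallyOrdered (f := f c) hd).trans
      (Finset.single_le_sum_of_canonicallyOrdered (f := fun c => ∑ d ∈ s, f c d) hc)
  have hpt : ∀ ω, ENNReal.ofReal (Real.exp (l * ‖A ω‖)) ≤
      ∑ c ∈ s, ∑ d ∈ s,
        ENNReal.ofReal (Real.exp (∑ t : m × m, (l * (d t.1 * c t.2)) * A ω t.1 t.2)) := by
    intro ω
    obtain ⟨c, hc, d, hd, hle⟩ :=
      exists_net_norm_le s hnet (Matrix.toEuclideanCLM (n := m) (𝕜 := ℝ) (A ω))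
    rw [hinner] at hle
    refine le_trans ?_ (hsingle (fun c d =>
      ENNReal.ofReal (Real.exp (∑ t : m × m, (l * (d t.1 * c t.2)) * A ω t.1 t.2))) c hc d hd)
    refine ENNReal.ofReal_le_ofReal (Real.exp_le_exp.2 ?_)
    refine (mul_le_mul_of_nonneg_left hle hl).trans_eq ?_
    rw [Finset.mul_sum]
    exact Finset.sum_congr rfl fun t _ => by ring
  have hmeas : ∀ c d : EuclideanSpace ℝ m, AEMeasurable (fun ω =>
      ENNReal.ofReal (Real.exp (∑ t : m × m, (l * (d t.1 * c t.2)) * A ω t.1 t.2))) P := by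
    intro c d
    refine (Real.measurable_exp.comp_aemeasurable ?_).ennreal_ofReal
    exact Finset.aemeasurable_fun_sum _ fun t _ => (hsub t).aemeasurable.const_mul _
  have hterm : ∀ c ∈ s, ∀ d ∈ s, ∫⁻ ω,
      ENNReal.ofReal (Real.exp (∑ t : m × m, (l * (d t.1 * c t.2)) * A ω t.1 t.2)) ∂P ≤
        ENNReal.ofReal (Real.exp (8 * l ^ 2)) := by
    intro c hc d hd
    refine (lintegral_exp_sum_mul_le hind hsub _).trans
      (ENNReal.ofReal_le_ofReal (Real.exp_le_exp.2 ?_))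
    have h1 : ∑ t : m × m, (l * (d t.1 * c t.2)) ^ 2 = l ^ 2 * (‖d‖ ^ 2 * ‖c‖ ^ 2) := by
      rw [EuclideanSpace.norm_sq_eq, EuclideanSpace.norm_sq_eq, Finset.sum_mul_sum,
        Fintype.sum_prod_type]
      simp only [mul_pow, Finset.mul_sum, Real.norm_eq_abs, sq_abs]
    have hc2 : ‖c‖ ^ 2 ≤ 4 := by nlinarith [hs2 c hc, norm_nonneg c]
    have hd2 : ‖d‖ ^ 2 ≤ 4 := by nlinarith [hs2 d hd, norm_nonneg d]
    have h2 : ‖d‖ ^ 2 * ‖c‖ ^ 2 ≤ 4 * 4 := mul_le_mul hd2 hc2 (sq_nonneg _) (by norm_num)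
    rw [h1]
    nlinarith [sq_nonneg l]
  calc ∫⁻ ω, ENNReal.ofReal (Real.exp (l * ‖A ω‖)) ∂P
      ≤ ∫⁻ ω, ∑ c ∈ s, ∑ d ∈ s,
        ENNReal.ofReal (Real.exp (∑ t : m × m, (l * (d t.1 * c t.2)) * A ω t.1 t.2)) ∂P :=
        lintegral_mono hpt
    _ = ∑ c ∈ s, ∑ d ∈ s, ∫⁻ ω,
        ENNReal.ofReal (Real.exp (∑ t : m × m, (l * (d t.1 * c t.2)) * A ω t.1 t.2)) ∂P := by
        rw [lintegral_finsetSum' _ fun c _ => Finset.aemeasurable_fun_sum _ fun d _ => hmeas c d]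
        exact Finset.sum_congr rfl fun c _ => lintegral_finsetSum' _ fun d _ => hmeas c d
    _ ≤ ∑ _c ∈ s, ∑ _d ∈ s, ENNReal.ofReal (Real.exp (8 * l ^ 2)) :=
        Finset.sum_le_sum fun c hc => Finset.sum_le_sum fun d hd => hterm c hc d hd
    _ = ((s.card * s.card : ℕ) : ENNReal) * ENNReal.ofReal (Real.exp (8 * l ^ 2)) := by
        simp [mul_assoc]
    _ ≤ ((25 ^ Fintype.card m : ℕ) : ENNReal) * ENNReal.ofReal (Real.exp (8 * l ^ 2)) := by
        gcongr
        calc s.card * s.card ≤ 5 ^ Fintype.card m * 5 ^ Fintype.card m := Nat.mul_le_mul hcard hcard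
          _ = 25 ^ Fintype.card m := by rw [← mul_pow]; norm_num
    _ = _ := by
        rw [ENNReal.ofReal_mul (by positivity), ← ENNReal.ofReal_natCast]
        push_cast
        rfl

variable [IsProbabilityMeasure P]

/-- Moments of the operator norm of a sub-Gaussian matrix, up to order proportional to its size. -/
theorem lintegral_norm_pow_le (A : Ω → Matrix m m ℝ)
    (hind : iIndepFun (fun (t : m × m) ω => A ω t.1 t.2) P)
    (hsub : ∀ t : m × m, HasSubgaussianMGF (fun ω => A ω t.1 t.2) 1 P) [Nonempty m]
    {L : ℝ} (hL : 1 ≤ L) {r : ℕ} (hr : r ≤ L * Fintype.card m) :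
    ∫⁻ ω, ENNReal.ofReal (‖A ω‖ ^ r) ∂P ≤
      ENNReal.ofReal (2 * (Real.exp (4 + 8 * L) * √(Fintype.card m)) ^ r) := by
  set N : ℝ := (Fintype.card m : ℝ) with hN
  have hNpos : 0 < N := by rw [hN]; exact_mod_cast Fintype.card_pos
  have hsN : 0 < √N := Real.sqrt_pos.2 hNpos
  have hsq : √N ^ 2 = N := Real.sq_sqrt hNpos.le
  -- Chosen so that the bound `25 ^ N * exp (8 L² N)` on `E exp (L √N ‖A‖)` is at most `exp (L N
  -- D)`, using `25 ≤ exp 4` and `1 ≤ L`.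
  set D : ℝ := 4 + 8 * L with hD
  set c : ℝ := √N ^ r * Real.exp (r * D) with hc
  have hpt : ∀ ω, ‖A ω‖ ^ r ≤
      c * (1 + Real.exp (-(L * N * D)) * Real.exp (L * √N * ‖A ω‖)) := by
    intro ω
    set z : ℝ := ‖A ω‖ / √N with hz
    have hz0 : 0 ≤ z := by positivity
    have hA : ‖A ω‖ = √N * z := by rw [hz]; field_simp
    have h1 : z ^ r ≤ Real.exp (r * z) := by
      rw [Real.exp_nat_mul]
      exact pow_le_pow_left₀ hz0 (by linarith [Real.add_one_le_exp z]) r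
    -- Below the threshold `D` the exponential is at most `1`; above it, `r` may be raised to `L N`.
    have h2 : Real.exp (r * (z - D)) ≤ 1 + Real.exp (L * N * (z - D)) := by
      rcases le_total z D with h | h
      · have : Real.exp (r * (z - D)) ≤ 1 := Real.exp_le_one_iff.2
          (mul_nonpos_of_nonneg_of_nonpos (Nat.cast_nonneg _) (by linarith))
        linarith [Real.exp_pos (L * N * (z - D))]
      · have : Real.exp (r * (z - D)) ≤ Real.exp (L * N * (z - D)) :=
          Real.exp_le_exp.2 (mul_le_mul_of_nonneg_right hr (by linarith))
        linarith
    have h3 : Real.exp (r * z) = Real.exp (r * D) * Real.exp (r * (z - D)) := by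
      rw [← Real.exp_add]; ring_nf
    have h4 : Real.exp (-(L * N * D)) * Real.exp (L * √N * ‖A ω‖) =
        Real.exp (L * N * (z - D)) := by
      rw [← Real.exp_add, hA]; congr 1
      linear_combination (L * z) * hsq
    rw [h4, hc, hA, mul_pow, mul_assoc]
    refine mul_le_mul_of_nonneg_left ?_ (by positivity)
    rw [h3] at h1
    exact h1.trans (mul_le_mul_of_nonneg_left h2 (Real.exp_pos _).le)
  have hc0 : 0 ≤ c := by positivity
  have hexp := lintegral_exp_norm_le A hind hsub (l := L * √N) (by positivity)
  have h25 : (25 : ℝ) ^ Fintype.card m * Real.exp (8 * (L * √N) ^ 2) ≤ Real.exp (L * N * D) := by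
    have h1 : (25 : ℝ) ≤ Real.exp 4 := by
      have := Real.exp_one_gt_d9
      have h : Real.exp 4 = Real.exp 1 ^ 4 := by rw [← Real.exp_nat_mul]; norm_num
      rw [h]
      calc (25 : ℝ) ≤ 2.5 ^ 4 := by norm_num
        _ ≤ _ := pow_le_pow_left₀ (by norm_num) (by linarith) 4
    calc (25 : ℝ) ^ Fintype.card m * Real.exp (8 * (L * √N) ^ 2)
        ≤ Real.exp 4 ^ Fintype.card m * Real.exp (8 * (L * √N) ^ 2) := by gcongr
      _ = Real.exp (N * 4 + 8 * L ^ 2 * N) := by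
        rw [← Real.exp_nat_mul, ← Real.exp_add, mul_pow, hsq]
        congr 1; ring
      _ ≤ _ := Real.exp_le_exp.2 (by rw [hD]; nlinarith)
  calc ∫⁻ ω, ENNReal.ofReal (‖A ω‖ ^ r) ∂P
      ≤ ∫⁻ ω, ENNReal.ofReal c * (1 + ENNReal.ofReal (Real.exp (-(L * N * D))) *
          ENNReal.ofReal (Real.exp (L * √N * ‖A ω‖))) ∂P := by
        refine lintegral_mono fun ω => ?_
        rw [← ENNReal.ofReal_mul (by positivity), ← ENNReal.ofReal_one,
          ← ENNReal.ofReal_add zero_le_one (by positivity), ← ENNReal.ofReal_mul hc0]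
        exact ENNReal.ofReal_le_ofReal (hpt ω)
    _ = ENNReal.ofReal c * (1 + ENNReal.ofReal (Real.exp (-(L * N * D))) *
          ∫⁻ ω, ENNReal.ofReal (Real.exp (L * √N * ‖A ω‖)) ∂P) := by
        rw [lintegral_const_mul' _ _ ENNReal.ofReal_ne_top, lintegral_add_left measurable_const,
          lintegral_const_mul' _ _ ENNReal.ofReal_ne_top]
        simp
    _ ≤ ENNReal.ofReal c * (1 + ENNReal.ofReal (Real.exp (-(L * N * D))) *
          ENNReal.ofReal (Real.exp (L * N * D))) := by
        gcongr
        exact hexp.trans (ENNReal.ofReal_le_ofReal h25)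
    _ = _ := by
        rw [← ENNReal.ofReal_mul (Real.exp_pos _).le, ← Real.exp_add, neg_add_cancel,
          Real.exp_zero, ← ENNReal.ofReal_one, ← ENNReal.ofReal_add zero_le_one zero_le_one,
          ← ENNReal.ofReal_mul hc0]
        congr 1
        rw [hc, mul_pow, Real.exp_nat_mul]
        ring

end ExponentialMoment

/-! ### Symmetrization -/

section Symmetrization

variable {V : Type*} [NormedAddCommGroup V]

theorem lintegral_enorm_pow_ge {α : Type*} [MeasurableSpace α] {Q : Measure α}
    [IsProbabilityMeasure Q] {f : α → V} (hf : AEStronglyMeasurable f Q) {q : ℕ} (hq : 1 ≤ q) :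
    (∫⁻ a, ‖f a‖ₑ ∂Q) ^ q ≤ ∫⁻ a, ‖f a‖ₑ ^ q ∂Q := by
  have h := eLpNorm_le_eLpNorm_of_exponent_le (μ := Q) (p := 1) (q := ((q : NNReal) : ENNReal))
    (by exact_mod_cast hq) hf
  have h2 := eLpNorm_nnreal_pow_eq_lintegral (μ := Q) (f := f) (p := (q : NNReal))
    (by exact_mod_cast (by omega : q ≠ 0))
  rw [eLpNorm_one_eq_lintegral_enorm] at h
  simp only [NNReal.coe_natCast, ENNReal.rpow_natCast] at h2
  rw [← h2]
  gcongr

variable [NormedSpace ℝ V]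

/-- The mean is written as the average over an independent copy, and Jensen's inequality moves the
power inside. -/
theorem lintegral_enorm_sub_integral_pow_le [CompleteSpace V] {α : Type*} [MeasurableSpace α]
    {Q : Measure α} [IsProbabilityMeasure Q] {F : α → V} (hF : Integrable F Q) {q : ℕ}
    (hq : 1 ≤ q) :
    ∫⁻ a, ‖F a - ∫ b, F b ∂Q‖ₑ ^ q ∂Q ≤ ∫⁻ a, ∫⁻ b, ‖F a - F b‖ₑ ^ q ∂Q ∂Q := by
  refine lintegral_mono fun a => ?_
  have h1 : F a - ∫ b, F b ∂Q = ∫ b, (F a - F b) ∂Q := by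
    rw [integral_sub (integrable_const _) hF]; simp
  rw [h1]
  refine (pow_le_pow_left₀ zero_le (enorm_integral_le_lintegral_enorm _) q).trans ?_
  exact lintegral_enorm_pow_ge ((integrable_const _).sub hF).aestronglyMeasurable hq

/-- Regrouped as a family of pairs, the map swaps some of the pairs, and each `ν.prod ν` is
symmetric. -/
theorem measurePreserving_cond_swap {τ : Type*} [Fintype τ] (ν : Measure ℝ)
    [IsProbabilityMeasure ν] (s : τ → Bool) :
    MeasurePreserving (fun x : (τ → ℝ) × (τ → ℝ) =>
      ((fun t => cond (s t) (x.1 t) (x.2 t), fun t => cond (s t) (x.2 t) (x.1 t)) :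
        (τ → ℝ) × (τ → ℝ)))
      ((Measure.pi fun _ => ν).prod (Measure.pi fun _ => ν))
      ((Measure.pi fun _ => ν).prod (Measure.pi fun _ => ν)) := by
  have he := measurePreserving_arrowProdEquivProdArrow ℝ ℝ τ (fun _ => ν) (fun _ => ν)
  have hmid : MeasurePreserving (fun (a : τ → ℝ × ℝ) t => cond (s t) (a t) (a t).swap)
      (Measure.pi fun _ => ν.prod ν) (Measure.pi fun _ => ν.prod ν) := by
    refine measurePreserving_pi (fun _ => ν.prod ν) (fun _ => ν.prod ν)
      (f := fun t x => cond (s t) x x.swap) fun t => ?_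
    cases s t
    · exact Measure.measurePreserving_swap
    · exact MeasurePreserving.id _
  convert! (he.comp hmid).comp (he.symm _) using 1
  funext x
  refine Prod.ext (funext fun t => ?_) (funext fun t => ?_) <;>
  · cases h : s t <;>
      simp [MeasurableEquiv.arrowProdEquivProdArrow, Equiv.arrowProdEquivProdArrow, h]

/-- Symmetrization: centering a sum of independent terms is controlled by random signs. -/
theorem lintegral_enorm_sum_sub_integral_pow_le [CompleteSpace V] {ι κ : Type*} [Fintype ι]
    [Fintype κ] (ν : Measure ℝ) [IsProbabilityMeasure ν] {G : (κ → ℝ) → V} (hG : Continuous G)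
    (hint : Integrable (fun a : ι × κ → ℝ => ∑ i, G fun k => a (i, k)) (Measure.pi fun _ => ν))
    {q : ℕ} (hq : 1 ≤ q) (ε : ι → Bool) :
    ∫⁻ a : ι × κ → ℝ, ‖∑ i, G (fun k => a (i, k)) -
        ∫ b : ι × κ → ℝ, ∑ i, G (fun k => b (i, k)) ∂(Measure.pi fun _ => ν)‖ₑ ^ q
          ∂(Measure.pi fun _ => ν) ≤
      2 ^ (q + 1) * ∫⁻ a : ι × κ → ℝ, ‖∑ i, boolSign (ε i) • G fun k => a (i, k)‖ₑ ^ q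
        ∂(Measure.pi fun _ => ν) := by
  set Q : Measure (ι × κ → ℝ) := Measure.pi fun _ => ν with hQ
  set H : (ι × κ → ℝ) → V := fun a => ∑ i, boolSign (ε i) • G fun k => a (i, k) with hH
  have hHc : Continuous H := by rw [hH]; fun_prop
  refine (lintegral_enorm_sub_integral_pow_le hint hq).trans ?_
  have hD : Measurable fun x : (ι × κ → ℝ) × (ι × κ → ℝ) =>
      ‖∑ i, G (fun k => x.1 (i, k)) - ∑ i, G (fun k => x.2 (i, k))‖ₑ ^ q := by
    refine Measurable.pow_const (Continuous.measurable ?_) q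
    fun_prop
  have hHm : Measurable fun a => ‖H a‖ₑ ^ q :=
    Measurable.pow_const (Continuous.measurable (by fun_prop)) q
  -- Swapping the two copies of the blocks with `ε i = false` turns the difference of the sums into
  -- the signed difference `H x.1 - H x.2`.
  rw [← lintegral_prod _ hD.aemeasurable,
    ← (measurePreserving_cond_swap ν fun t : ι × κ => ε t.1).lintegral_comp hD]
  calc _ ≤ ∫⁻ x, (2 ^ q * ‖H x.1‖ₑ ^ q + 2 ^ q * ‖H x.2‖ₑ ^ q) ∂(Q.prod Q) := by
        refine lintegral_mono fun x => ?_
        have h1 : (∑ i, G (fun k => cond (ε i) (x.1 (i, k)) (x.2 (i, k))) -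
            ∑ i, G (fun k => cond (ε i) (x.2 (i, k)) (x.1 (i, k)))) = H x.1 - H x.2 := by
          simp only [hH]
          rw [← Finset.sum_sub_distrib, ← Finset.sum_sub_distrib]
          refine Finset.sum_congr rfl fun i _ => ?_
          cases ε i <;> simp [boolSign]
          abel
        simp only [h1]
        have h2 : ‖H x.1 - H x.2‖ₑ ≤ 2 * max ‖H x.1‖ₑ ‖H x.2‖ₑ := by
          refine enorm_sub_le.trans ?_
          rw [two_mul]
          exact add_le_add (le_max_left _ _) (le_max_right _ _)
        refine (pow_le_pow_left₀ zero_le h2 q).trans ?_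
        rw [mul_pow]
        rcases max_choice ‖H x.1‖ₑ ‖H x.2‖ₑ with h | h <;> rw [h]
        · exact le_self_add
        · exact le_add_self
    _ = _ := by
        have h1 : Measurable fun x : (ι × κ → ℝ) × (ι × κ → ℝ) => ‖H x.1‖ₑ ^ q :=
          hHm.comp measurable_fst
        have h2 : Measurable fun x : (ι × κ → ℝ) × (ι × κ → ℝ) => ‖H x.2‖ₑ ^ q :=
          hHm.comp measurable_snd
        rw [lintegral_add_left (h1.const_mul _), lintegral_const_mul _ h1,
          lintegral_const_mul _ h2, lintegral_prod _ h1.aemeasurable,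
          lintegral_prod _ h2.aemeasurable]
        simp only [lintegral_const, measure_univ, mul_one]
        rw [pow_succ]
        ring

end Symmetrization

/-! ### Entrywise integration of matrices -/

section MatrixIntegral

variable {m : Type*} [Fintype m] [DecidableEq m] {α : Type*} [MeasurableSpace α] {Q : Measure α}

theorem integrable_matrix_of_entries {f : α → Matrix m m ℝ}
    (h : ∀ a b, Integrable (fun x => f x a b) Q) : Integrable f Q := by
  have h1 : f = fun x => ∑ a, ∑ b, f x a b • Matrix.single a b (1 : ℝ) := by
    funext x
    conv_lhs => rw [Matrix.matrix_eq_sum_single (f x)]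
    simp [Matrix.smul_single]
  rw [h1]
  exact integrable_finsetSum _ fun a _ => integrable_finsetSum _ fun b _ =>
    (h a b).smul_const _

theorem integral_matrix_apply {f : α → Matrix m m ℝ} (h : Integrable f Q) (a b : m) :
    (∫ x, f x ∂Q) a b = ∫ x, f x a b ∂Q :=
  ((Matrix.entryLinearMap ℝ ℝ a b).toContinuousLinearMap.integral_comp_comm h).symm

end MatrixIntegral

/-! ### A common model for `A ⊗ A` and `A ⊗ Aᵀ` -/

section QuadraticMap

variable {m n : Type*} [Fintype m] [DecidableEq m] [Fintype n] [DecidableEq n]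

/-- A matrix-valued map whose entries are products of two coordinates of its matrix argument and
whose norm is at most the square of the norm of the argument. -/
structure IsQuadraticMatrixMap (G : (m × m → ℝ) → Matrix n n ℝ) : Prop where
  entries : ∀ a b, ∃ t s, ∀ x, G x a b = x t * x s
  norm_le : ∀ x, ‖G x‖ ≤ ‖(Matrix.of fun j l => x (j, l) : Matrix m m ℝ)‖ ^ 2

theorem IsQuadraticMatrixMap.continuous {G : (m × m → ℝ) → Matrix n n ℝ}
    (hG : IsQuadraticMatrixMap G) : Continuous G := by
  refine continuous_matrix fun a b => ?_
  obtain ⟨t, s, h⟩ := hG.entries a b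
  simp only [h]
  fun_prop

theorem isQuadraticMatrixMap_kronecker :
    IsQuadraticMatrixMap fun x : m × m → ℝ =>
      (Matrix.of fun j l => x (j, l) : Matrix m m ℝ) ⊗ₖ (Matrix.of fun j l => x (j, l)) where
  entries a b := ⟨(a.1, b.1), (a.2, b.2), fun _ => rfl⟩
  norm_le _ := (norm_kronecker_le _ _).trans_eq (sq _).symm

theorem isQuadraticMatrixMap_kronecker_transpose :
    IsQuadraticMatrixMap fun x : m × m → ℝ =>
      (Matrix.of fun j l => x (j, l) : Matrix m m ℝ) ⊗ₖ
        (Matrix.of fun j l => x (j, l) : Matrix m m ℝ).transpose where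
  entries a b := ⟨(a.1, b.1), (b.2, a.2), fun _ => rfl⟩
  norm_le _ := (norm_kronecker_le _ _).trans_eq (by rw [norm_transpose_matrix, sq])

end QuadraticMap

/-! ### Moment and tail bounds for the centred sum -/

section Tail

variable {ι m n : Type*} [Fintype ι] [Fintype m] [DecidableEq m]
  [Fintype n] [DecidableEq n] {ν : Measure ℝ} [IsProbabilityMeasure ν]

theorem hasSubgaussianMGF_eval {τ : Type*} [Fintype τ] (hν : HasSubgaussianMGF id 1 ν) (t : τ) :
    HasSubgaussianMGF (fun a : τ → ℝ => a t) 1 (Measure.pi fun _ => ν) := by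
  have h := measurePreserving_eval (fun _ : τ => ν) t
  rw [← HasSubgaussianMGF.id_map_iff (measurable_pi_apply t).aemeasurable]
  rwa [show (fun a : τ → ℝ => a t) = Function.eval t from rfl, h.map_eq]

theorem iIndepFun_eval {τ : Type*} [Fintype τ] :
    iIndepFun (fun (t : τ) (a : τ → ℝ) => a t) (Measure.pi fun _ => ν) :=
  iIndepFun_pi (X := fun _ => id) fun _ => aemeasurable_id

theorem IsQuadraticMatrixMap.integrable {G : (m × m → ℝ) → Matrix n n ℝ}
    (hG : IsQuadraticMatrixMap G) (hν : HasSubgaussianMGF id 1 ν) (i : ι) :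
    Integrable (fun a : ι × (m × m) → ℝ => G fun t => a (i, t)) (Measure.pi fun _ => ν) := by
  refine integrable_matrix_of_entries fun a b => ?_
  obtain ⟨t, s, h⟩ := hG.entries a b
  simp only [h]
  exact MemLp.integrable_mul (p := 2) (q := 2)
    ((hasSubgaussianMGF_eval hν (i, t)).memLp 2) ((hasSubgaussianMGF_eval hν (i, s)).memLp 2)

variable [Nonempty m]

theorem lintegral_block_norm_pow_le (hν : HasSubgaussianMGF id 1 ν) (i : ι)
    {L : ℝ} (hL : 1 ≤ L) {r : ℕ} (hr : r ≤ L * Fintype.card m) :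
    ∫⁻ a : ι × (m × m) → ℝ,
        ENNReal.ofReal (‖(Matrix.of fun j l => a (i, (j, l)) : Matrix m m ℝ)‖ ^ r)
          ∂(Measure.pi fun _ => ν) ≤
      ENNReal.ofReal (2 * (Real.exp (4 + 8 * L) * √(Fintype.card m)) ^ r) :=
  lintegral_norm_pow_le (fun a : ι × (m × m) → ℝ => Matrix.of fun j l => a (i, (j, l)))
    ((iIndepFun_eval (ν := ν)).precomp (g := fun t : m × m => (i, t))
      (Prod.mk_right_injective i))
    (fun t => hasSubgaussianMGF_eval hν (i, t)) hL hr

variable [DecidableEq ι]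

/-- Even moments of the centered sum of independent quadratic matrices. -/
theorem IsQuadraticMatrixMap.lintegral_deviation_le {G : (m × m → ℝ) → Matrix n n ℝ}
    (hG : IsQuadraticMatrixMap G) (hν : HasSubgaussianMGF id 1 ν) {L : ℝ} (hL : 1 ≤ L) {j p : ℕ}
    (hp : p = 2 ^ (j + 1)) (hr : ((4 * p : ℕ) : ℝ) ≤ L * Fintype.card m) :
    ∫⁻ a : ι × (m × m) → ℝ, ‖∑ i, G (fun t => a (i, t)) -
        ∫ b : ι × (m × m) → ℝ, ∑ i, G (fun t => b (i, t)) ∂(Measure.pi fun _ => ν)‖ₑ ^ (2 * p)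
          ∂(Measure.pi fun _ => ν) ≤
      ENNReal.ofReal (8 * Fintype.card n * (8 * p * Real.exp 1 * Fintype.card ι *
        Real.exp (4 + 8 * L) ^ 4 * (Fintype.card m : ℝ) ^ 2) ^ p) := by
  set Q : Measure (ι × (m × m) → ℝ) := Measure.pi fun _ => ν with hQ
  set k := Fintype.card ι with hk
  set I := ∫⁻ a : ι × (m × m) → ℝ, ‖∑ i, G (fun t => a (i, t)) -
        ∫ b : ι × (m × m) → ℝ, ∑ i, G (fun t => b (i, t)) ∂Q‖ₑ ^ (2 * p) ∂Q with hI
  have hp1 : 1 ≤ p := hp ▸ Nat.one_le_two_pow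
  have hGc := hG.continuous
  have hint : Integrable (fun a : ι × (m × m) → ℝ => ∑ i, G fun t => a (i, t)) Q :=
    integrable_finsetSum _ fun i _ => hG.integrable hν i
  have hsym := fun ε : ι → Bool =>
    lintegral_enorm_sum_sub_integral_pow_le ν hGc hint (q := 2 * p) (by omega) ε
  set E : (ι × (m × m) → ℝ) → ι → ℝ := fun a i =>
    ‖(Matrix.of fun j l => a (i, (j, l)) : Matrix m m ℝ)‖ with hE
  set c : ℝ := Fintype.card n * (2 ^ k * (2 * ((2 * p * Real.exp 1) ^ p * k ^ (p - 1)))) with hc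
  have hc0 : 0 ≤ c := by positivity
  have hpt : ∀ a : ι × (m × m) → ℝ,
      ∑ ε : ι → Bool, ‖∑ i, boolSign (ε i) • G fun t => a (i, t)‖ₑ ^ (2 * p) ≤
        ENNReal.ofReal c * ∑ i, ENNReal.ofReal (E a i ^ (4 * p)) := by
    intro a
    have h1 := sum_norm_pow_sign_le (fun i => G fun t => a (i, t)) j
    rw [← hp] at h1
    have h2 : ∑ i, ‖G fun t => a (i, t)‖ ^ 2 ≤ ∑ i, E a i ^ 4 :=
      Finset.sum_le_sum fun i _ => by
        have := pow_le_pow_left₀ (norm_nonneg _) (hG.norm_le fun t => a (i, t)) 2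
        rwa [← pow_mul] at this
    -- The power mean inequality separates the blocks, so only moments of order `4 p` of one matrix
    -- are needed.
    have h3 : (∑ i, E a i ^ 4) ^ p ≤ (k : ℝ) ^ (p - 1) * ∑ i, E a i ^ (4 * p) := by
      have := pow_sum_le_card_mul_sum_pow (s := Finset.univ) (f := fun i => E a i ^ 4)
        (fun i _ => by positivity) (p - 1)
      simpa only [Nat.sub_add_cancel hp1, ← pow_mul, Finset.card_univ] using this
    have h4 : ∑ ε : ι → Bool, ‖∑ i, boolSign (ε i) • G fun t => a (i, t)‖ ^ (2 * p) ≤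
        c * ∑ i, E a i ^ (4 * p) := by
      refine h1.trans ?_
      have hr : c * ∑ i, E a i ^ (4 * p) = Fintype.card n * (2 ^ k *
          (2 * ((2 * p * Real.exp 1) ^ p * (k ^ (p - 1) * ∑ i, E a i ^ (4 * p))))) := by
        rw [hc]; ring
      rw [hr]
      refine mul_le_mul_of_nonneg_left ?_ (Nat.cast_nonneg _)
      refine mul_le_mul_of_nonneg_left ?_ (by positivity)
      refine mul_le_mul_of_nonneg_left ?_ zero_le_two
      rw [mul_pow]
      refine mul_le_mul_of_nonneg_left ?_ (by positivity)
      exact (pow_le_pow_left₀ (by positivity) h2 p).trans h3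
    have h5 := ENNReal.ofReal_le_ofReal h4
    rw [ENNReal.ofReal_mul hc0, ENNReal.ofReal_sum_of_nonneg (fun i _ => by positivity),
      ENNReal.ofReal_sum_of_nonneg (fun i _ => by positivity)] at h5
    refine le_trans (le_of_eq ?_) h5
    refine Finset.sum_congr rfl fun ε _ => ?_
    rw [ENNReal.ofReal_pow (norm_nonneg _), ofReal_norm]
  have hEm : ∀ i, Measurable fun a => ENNReal.ofReal (E a i ^ (4 * p)) := fun i => by
    refine (Continuous.measurable ?_).ennreal_ofReal
    simp only [hE]
    fun_prop
  have hHm : ∀ ε : ι → Bool, Measurable fun a : ι × (m × m) → ℝ =>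
      ‖∑ i, boolSign (ε i) • G fun t => a (i, t)‖ₑ ^ (2 * p) := fun ε =>
    Measurable.pow_const (Continuous.measurable (by fun_prop)) _
  set B : ℝ := 2 * (Real.exp (4 + 8 * L) * √(Fintype.card m)) ^ (4 * p) with hB
  -- Symmetrization holds for every fixed sign pattern; summing over all `2 ^ k` of them allows the
  -- sign moments to be taken before integrating the matrices.
  have hmain : (2 ^ k : ENNReal) * I ≤
      2 ^ k * ENNReal.ofReal (8 * Fintype.card n * (8 * p * Real.exp 1 * k *
        Real.exp (4 + 8 * L) ^ 4 * (Fintype.card m : ℝ) ^ 2) ^ p) := by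
    calc (2 ^ k : ENNReal) * I = ∑ _ε : ι → Bool, I := by simp [hk]
      _ ≤ ∑ ε : ι → Bool, 2 ^ (2 * p + 1) *
          ∫⁻ a : ι × (m × m) → ℝ, ‖∑ i, boolSign (ε i) • G fun t => a (i, t)‖ₑ ^ (2 * p) ∂Q :=
          Finset.sum_le_sum fun ε _ => hsym ε
      _ = 2 ^ (2 * p + 1) * ∫⁻ a : ι × (m × m) → ℝ,
          ∑ ε : ι → Bool, ‖∑ i, boolSign (ε i) • G fun t => a (i, t)‖ₑ ^ (2 * p) ∂Q := by
          rw [← Finset.mul_sum, lintegral_finsetSum _ fun ε _ => hHm ε]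
      _ ≤ 2 ^ (2 * p + 1) * ∫⁻ a : ι × (m × m) → ℝ,
          ENNReal.ofReal c * ∑ i, ENNReal.ofReal (E a i ^ (4 * p)) ∂Q := by
          gcongr with a
          exact hpt a
      _ = 2 ^ (2 * p + 1) * (ENNReal.ofReal c *
          ∑ i, ∫⁻ a : ι × (m × m) → ℝ, ENNReal.ofReal (E a i ^ (4 * p)) ∂Q) := by
          rw [lintegral_const_mul' _ _ ENNReal.ofReal_ne_top,
            lintegral_finsetSum _ fun i _ => hEm i]
      _ ≤ 2 ^ (2 * p + 1) * (ENNReal.ofReal c * ∑ _i : ι, ENNReal.ofReal B) := by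
          gcongr with i
          exact lintegral_block_norm_pow_le hν i hL hr
      _ = ENNReal.ofReal (2 ^ (2 * p + 1) * (c * (k * B))) := by
          rw [ENNReal.ofReal_mul (p := 2 ^ (2 * p + 1)) (by positivity), ENNReal.ofReal_mul hc0,
            ENNReal.ofReal_mul (Nat.cast_nonneg _), ENNReal.ofReal_pow zero_le_two]
          simp [hk]
      _ = _ := by
          have h2 : (2 : ENNReal) ^ k = ENNReal.ofReal (2 ^ k) := by
            rw [ENNReal.ofReal_pow zero_le_two]; simp
          rw [h2, ← ENNReal.ofReal_mul (by positivity)]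
          congr 1
          have hkp : (k : ℝ) ^ (p - 1) * k = (k : ℝ) ^ p := by
            rw [← pow_succ, Nat.sub_add_cancel hp1]
          have hs : √(Fintype.card m : ℝ) ^ (4 * p) = ((Fintype.card m : ℝ) ^ 2) ^ p := by
            rw [pow_mul, show 4 = 2 * 2 from rfl, pow_mul, Real.sq_sqrt (Nat.cast_nonneg _)]
          have h22 : (2 : ℝ) ^ (2 * p + 1) = 2 * 4 ^ p := by
            rw [pow_succ, pow_mul]; norm_num [mul_comm]
          have h8 : (8 * p * Real.exp 1 * k * Real.exp (4 + 8 * L) ^ 4 *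
              (Fintype.card m : ℝ) ^ 2) ^ p = 4 ^ p * (2 * p * Real.exp 1) ^ p * (k : ℝ) ^ p *
              Real.exp (4 + 8 * L) ^ (4 * p) * ((Fintype.card m : ℝ) ^ 2) ^ p := by
            rw [pow_mul (Real.exp (4 + 8 * L)), ← mul_pow, ← mul_pow, ← mul_pow, ← mul_pow]
            congr 1; ring
          rw [hc, hB, h22, h8, mul_pow (Real.exp (4 + 8 * L)), hs, ← hkp]
          ring
  exact (ENNReal.mul_le_mul_iff_right (by simp) (by simp)).1 hmain

/-- The constant in the tail bound for sums of independent quadratic matrices. -/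
noncomputable def deviationConst : ℝ :=
  √(816 * Real.exp 1 ^ 3 * Real.exp (4 + 8 * 408) ^ 4)

theorem deviationConst_pos : 0 < deviationConst := Real.sqrt_pos.2 (by positivity)

theorem exists_two_pow_between {x : ℝ} (hx : 1 ≤ x) :
    ∃ j : ℕ, x ≤ ((2 ^ (j + 1) : ℕ) : ℝ) ∧ ((2 ^ (j + 1) : ℕ) : ℝ) ≤ 2 * x := by
  obtain ⟨j, h1, h2⟩ := exists_nat_pow_near hx one_lt_two
  refine ⟨j, by push_cast; exact h2.le, ?_⟩
  push_cast
  rw [pow_succ]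
  linarith

theorem IsQuadraticMatrixMap.measure_deviation_le {G : (m × m → ℝ) → Matrix n n ℝ}
    (hG : IsQuadraticMatrixMap G) (hν : HasSubgaussianMGF id 1 ν) (hm : 2 ≤ Fintype.card m) :
    (Measure.pi fun _ => ν) {a : ι × (m × m) → ℝ |
        deviationConst * Fintype.card m * √(Fintype.card ι) * √(Real.log (Fintype.card m)) <
          ‖∑ i, G (fun t => a (i, t)) -
            ∫ b : ι × (m × m) → ℝ, ∑ i, G (fun t => b (i, t)) ∂(Measure.pi fun _ => ν)‖} ≤
      ENNReal.ofReal (8 * Fintype.card n * (Fintype.card m : ℝ) ^ (-102 : ℤ)) := by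
  rcases isEmpty_or_nonempty ι with hι | hι
  · simp
  set Q : Measure (ι × (m × m) → ℝ) := Measure.pi fun _ => ν with hQ
  set D : (ι × (m × m) → ℝ) → Matrix n n ℝ := fun a => ∑ i, G (fun t => a (i, t)) -
            ∫ b : ι × (m × m) → ℝ, ∑ i, G (fun t => b (i, t)) ∂Q with hD
  set N : ℝ := (Fintype.card m : ℝ) with hN
  have hN2 : (2 : ℝ) ≤ N := by rw [hN]; exact_mod_cast hm
  have hlog2 := Real.log_two_gt_d9
  have hlog : Real.log 2 ≤ Real.log N := Real.log_le_log two_pos hN2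
  have hlogN : Real.log N ≤ N := (Real.log_le_sub_one_of_pos (by linarith)).trans (by linarith)
  -- Here `51 log N ≤ p ≤ 102 log N`. The lower bound gives `exp (-2p) ≤ N ^ (-102)`; the upper one
  -- gives `4 p ≤ 408 N`, whence `L = 408`, and `8 * 102 = 816` in `deviationConst`.
  obtain ⟨j, hj1, hj2⟩ := exists_two_pow_between (x := 51 * Real.log N) (by linarith)
  obtain ⟨p, hp⟩ : ∃ p : ℕ, p = 2 ^ (j + 1) := ⟨_, rfl⟩
  rw [← hp] at hj1 hj2
  have hp0 : (0 : ℝ) < p := by linarith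
  have hk0 : (0 : ℝ) < Fintype.card ι := by exact_mod_cast Fintype.card_pos
  set k : ℝ := (Fintype.card ι : ℝ) with hk
  have hmom := hG.lintegral_deviation_le (ι := ι) hν (L := 408) (by norm_num) hp
    (by push_cast; linarith)
  rw [← hQ, ← hk, ← hN] at hmom
  set M : ℝ := 8 * p * Real.exp 1 * k * Real.exp (4 + 8 * 408) ^ 4 * N ^ 2 with hM
  have hM0 : 0 < M := by positivity
  set t : ℝ := deviationConst * N * √k * √(Real.log N) with ht
  have ht0 : 0 < t := by
    have := deviationConst_pos
    have : 0 < √(Real.log N) := Real.sqrt_pos.2 (by linarith)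
    positivity
  have ht2 : t ^ 2 = 816 * Real.exp 1 ^ 3 * Real.exp (4 + 8 * 408) ^ 4 * N ^ 2 * k *
      Real.log N := by
    rw [ht, mul_pow, mul_pow, mul_pow, deviationConst, Real.sq_sqrt (by positivity),
      Real.sq_sqrt hk0.le, Real.sq_sqrt (by linarith)]
  -- The threshold exceeds the moment scale by a factor `e`, so Markov's inequality gains `exp
  -- (-2p)`.
  have htM : Real.exp 1 ^ 2 * M ≤ t ^ 2 := by
    have h1 : Real.exp 1 ^ 2 * M =
        (8 * Real.exp 1 ^ 3 * Real.exp (4 + 8 * 408) ^ 4 * N ^ 2 * k) * p := by rw [hM]; ring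
    have h2 : t ^ 2 = (8 * Real.exp 1 ^ 3 * Real.exp (4 + 8 * 408) ^ 4 * N ^ 2 * k) *
        (2 * (51 * Real.log N)) := by rw [ht2]; ring
    rw [h1, h2]
    exact mul_le_mul_of_nonneg_left hj2 (by positivity)
  have hsub : {a | t < ‖D a‖} ⊆ {a | ENNReal.ofReal (t ^ (2 * p)) ≤ ‖D a‖ₑ ^ (2 * p)} := by
    intro a ha
    rw [Set.mem_ofPred_eq] at ha ⊢
    rw [← ofReal_norm, ← ENNReal.ofReal_pow (norm_nonneg _)]
    exact ENNReal.ofReal_le_ofReal (pow_le_pow_left₀ ht0.le ha.le _)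
  have hmeas : AEMeasurable (fun a => ‖D a‖ₑ ^ (2 * p)) Q := by
    have := hG.continuous
    refine (Measurable.pow_const (Continuous.measurable ?_) _).aemeasurable
    simp only [hD]
    fun_prop
  refine (measure_mono hsub).trans ?_
  refine (meas_ge_le_lintegral_div hmeas (by simpa using pow_pos ht0 _)
    ENNReal.ofReal_ne_top).trans ?_
  refine (ENNReal.div_le_div_right hmom _).trans ?_
  rw [← ENNReal.ofReal_div_of_pos (by positivity)]
  refine ENNReal.ofReal_le_ofReal ?_
  rw [div_le_iff₀ (by positivity), mul_assoc (8 * (Fintype.card n : ℝ)) (N ^ (-102 : ℤ))]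
  refine mul_le_mul_of_nonneg_left ?_ (by positivity)
  have hexp : 1 ≤ N ^ (-102 : ℤ) * (Real.exp 1 ^ 2) ^ p := by
    rw [← pow_mul, ← Real.exp_nat_mul, mul_one]
    have h1 : N ^ (102 : ℕ) ≤ Real.exp ((2 * p : ℕ) : ℝ) := by
      calc N ^ 102 = Real.exp (Real.log N) ^ 102 := by rw [Real.exp_log (by linarith)]
        _ = Real.exp (102 * Real.log N) := by rw [← Real.exp_nat_mul]; norm_num
        _ ≤ _ := Real.exp_le_exp.2 (by push_cast; linarith)
    rw [zpow_neg, inv_mul_eq_div, one_le_div (by positivity)]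
    exact_mod_cast h1
  calc M ^ p = 1 * M ^ p := (one_mul _).symm
    _ ≤ (N ^ (-102 : ℤ) * (Real.exp 1 ^ 2) ^ p) * M ^ p := by gcongr
    _ = N ^ (-102 : ℤ) * (Real.exp 1 ^ 2 * M) ^ p := by
        rw [mul_pow (Real.exp 1 ^ 2) M, mul_assoc]
    _ ≤ N ^ (-102 : ℤ) * (t ^ 2) ^ p := by gcongr
    _ = _ := by rw [← pow_mul]

/-- Independence and the common law make the joint law of the entries the product measure, so the
tail bound transfers to any probability space. -/
theorem IsQuadraticMatrixMap.prob_deviation_le {G : (m × m → ℝ) → Matrix n n ℝ}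
    (hG : IsQuadraticMatrixMap G) (hν : HasSubgaussianMGF id 1 ν) (hm : 2 ≤ Fintype.card m)
    {Ω : Type*} [MeasurableSpace Ω] {P : Measure Ω} [IsProbabilityMeasure P]
    {X : ι × (m × m) → Ω → ℝ} (hlaw : ∀ t, HasLaw (X t) ν P) (hind : iIndepFun X P) :
    P {ω | deviationConst * Fintype.card m * √(Fintype.card ι) *
          √(Real.log (Fintype.card m)) <
        opNorm (∑ i, (G (fun t => X (i, t) ω) -
          expectMatrix P fun ω' => G fun t => X (i, t) ω'))} ≤
      ENNReal.ofReal (8 * Fintype.card n * (Fintype.card m : ℝ) ^ (-102 : ℤ)) := by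
  have hX : ∀ t, AEMeasurable (X t) P := fun t => (hlaw t).aemeasurable
  have hmap : P.map (fun ω t => X t ω) = Measure.pi fun _ => ν := by
    rw [(iIndepFun_iff_map_fun_eq_pi_map hX).1 hind]
    simp only [(hlaw _).map_eq]
  have hXm : AEMeasurable (fun ω t => X t ω) P := aemeasurable_pi_lambda _ hX
  have hexp : ∀ i, expectMatrix P (fun ω' => G fun t => X (i, t) ω') =
      ∫ b : ι × (m × m) → ℝ, G (fun t => b (i, t)) ∂(Measure.pi fun _ => ν) := by
    intro i
    ext a b
    rw [integral_matrix_apply (hG.integrable hν i), ← hmap, integral_map hXm]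
    · rfl
    · rw [hmap]
      obtain ⟨t, s, h⟩ := hG.entries a b
      simp only [h]
      exact Continuous.aestronglyMeasurable (by fun_prop)
  have hrw : ∀ ω, ∑ i, (G (fun t => X (i, t) ω) -
      expectMatrix P fun ω' => G fun t => X (i, t) ω') = ∑ i, G (fun t => X (i, t) ω) -
        ∫ b : ι × (m × m) → ℝ, ∑ i, G (fun t => b (i, t)) ∂(Measure.pi fun _ => ν) := by
    intro ω
    rw [integral_finsetSum _ fun i _ => hG.integrable hν i, Finset.sum_sub_distrib]
    simp only [hexp]
  simp only [hrw, opNorm_eq_norm]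
  refine le_trans (le_of_eq ?_) (hG.measure_deviation_le (ι := ι) hν hm)
  rw [← hmap, Measure.map_apply_of_aemeasurable hXm]
  · rfl
  · have := hG.continuous
    exact (isOpen_lt continuous_const (by fun_prop)).measurableSet

end Tail

/-! ### From norm deviation to boundedness of the cubic form -/

section Boundedness

variable {n : ℕ}

theorem eval_normSqPoly (x : Fin n → ℝ) :
    MvPolynomial.eval x (normSqPoly n) = ∑ i, x i ^ 2 := by
  simp [normSqPoly]

theorem eval_quadPoly (A : Matrix (Fin n) (Fin n) ℝ) (x : Fin n → ℝ) :
    MvPolynomial.eval x (quadPoly A) = ∑ i, ∑ j, A i j * (x i * x j) := by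
  simp [quadPoly]

theorem eval_quadPoly_sq (A : Matrix (Fin n) (Fin n) ℝ) (x : Fin n → ℝ) :
    MvPolynomial.eval x (quadPoly A) ^ 2 =
      ∑ a : Fin n × Fin n, ∑ b : Fin n × Fin n,
        (A ⊗ₖ A) a b * ((x a.1 * x a.2) * (x b.1 * x b.2)) := by
  rw [eval_quadPoly, sq, Finset.sum_mul_sum, Fintype.sum_prod_type]
  refine Finset.sum_congr rfl fun i _ => Finset.sum_congr rfl fun j _ => ?_
  rw [Finset.sum_mul_sum, Fintype.sum_prod_type]
  refine Finset.sum_congr rfl fun k _ => Finset.sum_congr rfl fun l _ => ?_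
  simp only [Matrix.kroneckerMap_apply]
  ring

theorem isMatrixRep_iff {M : Matrix (Fin n × Fin n) (Fin n × Fin n) ℝ}
    {p : MvPolynomial (Fin n) ℝ} :
    IsMatrixRep M p ↔ ∀ x : Fin n → ℝ, MvPolynomial.eval x p =
      ∑ a : Fin n × Fin n, ∑ b : Fin n × Fin n,
        M a b * ((x a.1 * x a.2) * (x b.1 * x b.2)) := by
  rw [IsMatrixRep, MvPolynomial.funext_iff]
  simp

theorem tensorPoly_eq_sum_X_mul_quadPoly (T : Fin n → Fin n → Fin n → ℝ) :
    tensorPoly T = ∑ i, MvPolynomial.X i * quadPoly (Matrix.of (T i)) := by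
  simp only [tensorPoly, quadPoly, Finset.mul_sum, Matrix.of_apply]
  exact Finset.sum_congr rfl fun i _ => Finset.sum_congr rfl fun j _ =>
    Finset.sum_congr rfl fun k _ => by ring

/-- The rank-one matrix `vec(I) vec(I)ᵀ`. -/
def vecIdMatrix (n : ℕ) : Matrix (Fin n × Fin n) (Fin n × Fin n) ℝ :=
  Matrix.of fun a b => (if a.1 = a.2 then 1 else 0) * (if b.1 = b.2 then 1 else 0)

theorem vecIdMatrix_transpose : (vecIdMatrix n).transpose = vecIdMatrix n := by
  ext a b
  simp only [vecIdMatrix, Matrix.transpose_apply, Matrix.of_apply]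
  exact mul_comm _ _

theorem isMatrixRep_one : IsMatrixRep (1 : Matrix (Fin n × Fin n) (Fin n × Fin n) ℝ)
    (normSqPoly n ^ 2) := by
  rw [isMatrixRep_iff]
  intro x
  rw [map_pow, eval_normSqPoly, sq, Finset.sum_mul_sum, Fintype.sum_prod_type]
  refine Finset.sum_congr rfl fun i _ => Finset.sum_congr rfl fun j _ => ?_
  simp only [Matrix.one_apply, ite_mul, one_mul, zero_mul, Finset.sum_ite_eq, Finset.mem_univ,
    if_true]
  ring

/-- A second representation of `‖x‖⁴`, besides the identity; it is what absorbs the expectation. -/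
theorem isMatrixRep_vecIdMatrix : IsMatrixRep (vecIdMatrix n) (normSqPoly n ^ 2) := by
  rw [isMatrixRep_iff]
  intro x
  have h : ∑ a : Fin n × Fin n, (if a.1 = a.2 then 1 else 0) * (x a.1 * x a.2) =
      ∑ i, x i ^ 2 := by
    rw [Fintype.sum_prod_type]
    simp [sq]
  rw [map_pow, eval_normSqPoly, ← h, sq, Finset.sum_mul_sum]
  refine Finset.sum_congr rfl fun a _ => Finset.sum_congr rfl fun b _ => ?_
  simp only [vecIdMatrix, Matrix.of_apply]
  ring

theorem sum_quartic_transpose (M : Matrix (Fin n × Fin n) (Fin n × Fin n) ℝ) (x : Fin n → ℝ) :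
    ∑ a : Fin n × Fin n, ∑ b : Fin n × Fin n,
        M.transpose a b * ((x a.1 * x a.2) * (x b.1 * x b.2)) =
      ∑ a : Fin n × Fin n, ∑ b : Fin n × Fin n,
        M a b * ((x a.1 * x a.2) * (x b.1 * x b.2)) := by
  rw [Finset.sum_comm]
  refine Finset.sum_congr rfl fun a _ => Finset.sum_congr rfl fun b _ => ?_
  rw [Matrix.transpose_apply]
  ring

theorem dotProduct_mulVec_le {m : Type*} [Fintype m] [DecidableEq m] (D : Matrix m m ℝ)
    (y : m → ℝ) : y ⬝ᵥ D.mulVec y ≤ ‖D‖ * (y ⬝ᵥ y) := by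
  have hy : y ⬝ᵥ y = ∑ i, y i ^ 2 := by simp [dotProduct, sq]
  have h0 : 0 ≤ ∑ i, y i ^ 2 := by positivity
  rw [hy]
  refine (le_abs_self _).trans (abs_le_of_sq_le_sq ?_ (by positivity))
  calc (y ⬝ᵥ D.mulVec y) ^ 2 ≤ (∑ i, y i ^ 2) * ∑ i, (D.mulVec y i) ^ 2 :=
        Finset.sum_mul_sq_le_sq_mul_sq _ _ _
    _ ≤ (∑ i, y i ^ 2) * (‖D‖ ^ 2 * ∑ i, y i ^ 2) := by
        gcongr
        exact sum_sq_mulVec_le D y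
    _ = _ := by ring

theorem isLambdaBounded_of_norm_sub_le (T : Fin n → Fin n → Fin n → ℝ) {lam : ℝ} (hlam : 0 < lam)
    (h : n + ‖∑ i, (Matrix.of (T i) ⊗ₖ Matrix.of (T i) - vecIdMatrix n)‖ ≤ lam ^ 2) :
    IsLambdaBounded (tensorPoly T) lam := by
  set B : Matrix (Fin n × Fin n) (Fin n × Fin n) ℝ :=
    ∑ i, Matrix.of (T i) ⊗ₖ Matrix.of (T i) with hB
  set W := vecIdMatrix n with hW
  set D := ∑ i, (Matrix.of (T i) ⊗ₖ Matrix.of (T i) - W) with hD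
  have hBD : B = D + (n : ℝ) • W := by
    rw [hD, Finset.sum_sub_distrib]
    simp [hB, Nat.cast_smul_eq_nsmul]
  -- The weights `lam ^ 2 - n` and `n` of the two representations add up to `lam ^ 2`. The
  -- antisymmetric term has zero quartic form and makes `R - B` symmetric, leaving `(lam ^ 2 - n) •
  -- 1` minus the symmetric part of `D`.
  set R : Matrix (Fin n × Fin n) (Fin n × Fin n) ℝ :=
    (lam ^ 2 - n) • 1 + (n : ℝ) • W + (1 / 2 : ℝ) • (B - B.transpose) with hR
  have hl2 : lam ^ 2 ≠ 0 := by positivity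
  refine ⟨fun i => Matrix.of (T i), (lam ^ 2)⁻¹ • R, tensorPoly_eq_sum_X_mul_quadPoly T, ?_, ?_⟩
  · rw [isMatrixRep_iff]
    intro x
    have h1 := isMatrixRep_iff.1 isMatrixRep_one x
    have h2 := isMatrixRep_iff.1 isMatrixRep_vecIdMatrix x
    have h3 := sum_quartic_transpose B x
    have h4 : ∑ a : Fin n × Fin n, ∑ b : Fin n × Fin n,
        ((lam ^ 2)⁻¹ • R) a b * ((x a.1 * x a.2) * (x b.1 * x b.2)) =
        (lam ^ 2)⁻¹ * ((lam ^ 2 - n) * (∑ a : Fin n × Fin n, ∑ b : Fin n × Fin n,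
          (1 : Matrix (Fin n × Fin n) (Fin n × Fin n) ℝ) a b *
            ((x a.1 * x a.2) * (x b.1 * x b.2))) +
          n * (∑ a : Fin n × Fin n, ∑ b : Fin n × Fin n,
            W a b * ((x a.1 * x a.2) * (x b.1 * x b.2))) +
          (1 / 2) * ((∑ a : Fin n × Fin n, ∑ b : Fin n × Fin n,
            B a b * ((x a.1 * x a.2) * (x b.1 * x b.2))) -
          (∑ a : Fin n × Fin n, ∑ b : Fin n × Fin n,
            B.transpose a b * ((x a.1 * x a.2) * (x b.1 * x b.2))))) := by
      simp only [Finset.mul_sum, ← Finset.sum_add_distrib, ← Finset.sum_sub_distrib]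
      refine Finset.sum_congr rfl fun a _ => Finset.sum_congr rfl fun b _ => ?_
      simp only [hR, Matrix.smul_apply, Matrix.add_apply, Matrix.sub_apply, smul_eq_mul]
      ring
    rw [h4, h3, ← h1, ← h2, sub_self]
    field_simp
    ring
  · have hS : lam ^ 2 • ((lam ^ 2)⁻¹ • R) - B =
        (lam ^ 2 - n) • 1 - (1 / 2 : ℝ) • (D + D.transpose) := by
      have hBT : B.transpose = D.transpose + (n : ℝ) • W := by
        rw [hBD, Matrix.transpose_add, Matrix.transpose_smul, hW, vecIdMatrix_transpose]
      rw [smul_smul, mul_inv_cancel₀ hl2, one_smul, hR, hBT, hBD]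
      module
    rw [hS]
    refine Matrix.PosSemidef.of_dotProduct_mulVec_nonneg ?_ fun y => ?_
    · rw [Matrix.IsHermitian, Matrix.conjTranspose_eq_transpose_of_trivial]
      simp [add_comm]
    · have h1 := dotProduct_mulVec_le D y
      have h2 : y ⬝ᵥ D.transpose.mulVec y = y ⬝ᵥ D.mulVec y := by
        rw [Matrix.mulVec_transpose, dotProduct_comm, Matrix.dotProduct_mulVec]
      have h3 : 0 ≤ y ⬝ᵥ y := Finset.sum_nonneg fun i _ => mul_self_nonneg _
      simp only [star_trivial, Matrix.sub_mulVec, Matrix.smul_mulVec, Matrix.one_mulVec,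
        Matrix.add_mulVec, dotProduct_sub, dotProduct_smul, dotProduct_add, smul_eq_mul, h2]
      nlinarith [mul_le_mul_of_nonneg_right h h3]

end Boundedness

/-! ### Sum-of-squares certificates and pseudo-expectations -/

section SumOfSquares

variable {n : ℕ}

theorem totalDegree_quadPoly_le (A : Matrix (Fin n) (Fin n) ℝ) : (quadPoly A).totalDegree ≤ 2 := by
  refine MvPolynomial.totalDegree_finsetSum_le fun i _ =>
    MvPolynomial.totalDegree_finsetSum_le fun j _ => ?_
  refine (MvPolynomial.totalDegree_mul _ _).trans ?_
  have h := MvPolynomial.totalDegree_mul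
    (MvPolynomial.X i : MvPolynomial (Fin n) ℝ) (MvPolynomial.X j)
  simp only [MvPolynomial.totalDegree_X, MvPolynomial.totalDegree_C] at *
  omega

theorem totalDegree_C_mul_le (c : ℝ) (p : MvPolynomial (Fin n) ℝ) :
    (MvPolynomial.C c * p).totalDegree ≤ p.totalDegree := by
  refine (MvPolynomial.totalDegree_mul _ _).trans ?_
  simp

theorem sum_comm_three {κ α β : Type*} [Fintype κ] [Fintype α] [Fintype β] (f : κ → α → β → ℝ) :
    ∑ i, ∑ a, ∑ b, f i a b = ∑ a, ∑ b, ∑ i, f i a b := by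
  rw [Finset.sum_comm]
  exact Finset.sum_congr rfl fun a _ => Finset.sum_comm

/-- A `lam`-bounded cubic form is dominated by norms up to a sum of squares. -/
theorem IsLambdaBounded.exists_sum_sq {f : MvPolynomial (Fin n) ℝ} {lam : ℝ}
    (hf : IsLambdaBounded f lam) {r : ℝ} (hr : 0 < r) :
    ∃ (k : ℕ) (s : Fin k → MvPolynomial (Fin n) ℝ), (∀ l, (s l).totalDegree ≤ 2) ∧
      MvPolynomial.C (r / 2) * normSqPoly n +
        MvPolynomial.C (lam ^ 2 / (2 * r)) * normSqPoly n ^ 2 - f = ∑ l, s l ^ 2 := by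
  obtain ⟨A, M, hfA, hM, hpsd⟩ := hf
  -- With `qᵢ = ⟨x, Aᵢ x⟩`, the difference is `1 / (2r)` times `∑ (r xᵢ - qᵢ)² + (lam² ‖x‖⁴ - ∑
  -- qᵢ²)`. The rank-one decomposition makes the last bracket a sum of squares of quadratic forms.
  obtain ⟨k, v, hv⟩ := Matrix.posSemidef_iff_eq_sum_vecMulVec.1 hpsd
  set c : ℝ := √(1 / (2 * r)) with hc
  have hc2 : c ^ 2 = 1 / (2 * r) := Real.sq_sqrt (by positivity)
  refine ⟨n + k, Fin.addCases
    (fun i => MvPolynomial.C c *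
      (MvPolynomial.C r * MvPolynomial.X i - quadPoly (A i)))
    (fun j => MvPolynomial.C c * quadPoly (Matrix.of fun a b => v j (a, b))), ?_, ?_⟩
  · intro l
    refine Fin.addCases (fun i => ?_) (fun j => ?_) l
    · simp only [Fin.addCases_left]
      refine (totalDegree_C_mul_le _ _).trans ((MvPolynomial.totalDegree_sub _ _).trans ?_)
      refine max_le ((totalDegree_C_mul_le _ _).trans ?_) (totalDegree_quadPoly_le _)
      simp
    · simp only [Fin.addCases_right]
      exact (totalDegree_C_mul_le _ _).trans (totalDegree_quadPoly_le _)
  · rw [MvPolynomial.funext_iff]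
    intro x
    have hq := isMatrixRep_iff.1 hM x
    rw [map_pow] at hq
    have hent : ∀ a b, lam ^ 2 * M a b - ∑ i, (A i ⊗ₖ A i) a b = ∑ j, v j a * v j b := by
      intro a b
      have := congrFun (congrFun hv a) b
      simpa [Matrix.sub_apply, Matrix.sum_apply, Matrix.vecMulVec_apply] using this
    have hj : ∀ j, MvPolynomial.eval x (quadPoly (Matrix.of fun a b => v j (a, b))) ^ 2 =
        ∑ a : Fin n × Fin n, ∑ b : Fin n × Fin n,
          (v j a * v j b) * ((x a.1 * x a.2) * (x b.1 * x b.2)) := by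
      intro j
      rw [eval_quadPoly, ← Fintype.sum_prod_type'
        (f := fun a b => (Matrix.of fun a b => v j (a, b)) a b * (x a * x b)), sq,
        Finset.sum_mul_sum]
      refine Finset.sum_congr rfl fun a _ => Finset.sum_congr rfl fun b _ => ?_
      simp only [Matrix.of_apply]
      ring
    have hkey : lam ^ 2 * MvPolynomial.eval x (normSqPoly n) ^ 2 =
        ∑ i, MvPolynomial.eval x (quadPoly (A i)) ^ 2 +
          ∑ j, MvPolynomial.eval x (quadPoly (Matrix.of fun a b => v j (a, b))) ^ 2 := by
      simp only [hj, eval_quadPoly_sq, hq]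
      rw [sum_comm_three (κ := Fin n), sum_comm_three (κ := Fin k), Finset.mul_sum, ← Finset.sum_add_distrib]
      refine Finset.sum_congr rfl fun a _ => ?_
      rw [Finset.mul_sum, ← Finset.sum_add_distrib]
      refine Finset.sum_congr rfl fun b _ => ?_
      rw [← Finset.sum_mul, ← Finset.sum_mul, ← hent]
      ring
    have hfx : MvPolynomial.eval x f = ∑ i, x i * MvPolynomial.eval x (quadPoly (A i)) := by
      rw [hfA]; simp
    rw [Fin.sum_univ_add]
    simp only [Fin.addCases_left, Fin.addCases_right, map_add, map_sub, map_mul, map_pow, map_sum,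
      MvPolynomial.eval_C, MvPolynomial.eval_X, mul_pow, hc2, ← Finset.mul_sum, hfx]
    have hexp : ∑ i, (r * x i - MvPolynomial.eval x (quadPoly (A i))) ^ 2 =
        r ^ 2 * MvPolynomial.eval x (normSqPoly n) -
          2 * r * ∑ i, x i * MvPolynomial.eval x (quadPoly (A i)) +
          ∑ i, MvPolynomial.eval x (quadPoly (A i)) ^ 2 := by
      rw [eval_normSqPoly, Finset.mul_sum, Finset.mul_sum, ← Finset.sum_sub_distrib,
        ← Finset.sum_add_distrib]
      exact Finset.sum_congr rfl fun i _ => by ring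
    rw [hexp]
    field_simp
    linear_combination hkey

/-- The polynomial `‖x‖²` as an element of the space of polynomials of degree at most `4`. -/
noncomputable def normSqLE (n : ℕ) : PolyLE n 4 :=
  ⟨normSqPoly n, (MvPolynomial.mem_restrictTotalDegree _ _ _).2
    ((totalDegree_normSqPoly_le n).trans (by norm_num))⟩

theorem sq_mem_polyLE {s : MvPolynomial (Fin n) ℝ} (hs : s.totalDegree ≤ 2) :
    s ^ 2 ∈ PolyLE n 4 :=
  (MvPolynomial.mem_restrictTotalDegree _ _ _).2
    ((MvPolynomial.totalDegree_pow _ _).trans (by omega))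

theorem one_mem_polyLE (d : ℕ) : (1 : MvPolynomial (Fin n) ℝ) ∈ PolyLE n d :=
  (MvPolynomial.mem_restrictTotalDegree _ _ _).2 (by simp)

theorem HasSoSCertificate.pseudoExpectation_le {T : Fin n → Fin n → Fin n → ℝ} {c : ℝ}
    (h : HasSoSCertificate (tensorPoly T) c) {L : PolyLE n 4 →ₗ[ℝ] ℝ}
    (hL : IsPseudoExpectation L) (hsat : SatisfiesEq L (normSqPoly n - 1)) :
    L (tensorLE T) ≤ c := by
  obtain ⟨k, s, q, hs, hq, heq⟩ := h
  have hmem : (normSqPoly n - 1) * q ∈ PolyLE n 4 := by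
    refine (MvPolynomial.mem_restrictTotalDegree _ _ _).2
      ((MvPolynomial.totalDegree_mul _ _).trans ?_)
    have h1 := MvPolynomial.totalDegree_sub (normSqPoly n) 1
    have h2 := totalDegree_normSqPoly_le n
    rw [MvPolynomial.totalDegree_one] at h1
    omega
  have hT : c • (⟨1, one_mem_polyLE 4⟩ : PolyLE n 4) = tensorLE T +
      (∑ l, (⟨s l ^ 2, sq_mem_polyLE (hs l)⟩ : PolyLE n 4)) + ⟨(normSqPoly n - 1) * q, hmem⟩ := by
    refine Subtype.ext ?_
    simp only [Submodule.coe_smul, Submodule.coe_add, Submodule.coe_sum, tensorLE]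
    rw [MvPolynomial.smul_eq_C_mul, mul_one, add_assoc, ← heq]
    ring
  have h1 := congrArg L hT
  rw [map_smul, map_add, map_add, map_sum, hL.map_one ⟨1, one_mem_polyLE 4⟩ rfl, hsat ⟨_, hmem⟩ q rfl] at h1
  have h2 : 0 ≤ ∑ l, L (⟨s l ^ 2, sq_mem_polyLE (hs l)⟩ : PolyLE n 4) :=
    Finset.sum_nonneg fun l _ => hL.map_sq_nonneg _ (s l) (hs l) rfl
  simp only [smul_eq_mul, mul_one, add_zero] at h1
  linarith

theorem HasSoSCertificate.eval_le {f : MvPolynomial (Fin n) ℝ} {c : ℝ}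
    (h : HasSoSCertificate f c) {v : EuclideanSpace ℝ (Fin n)} (hv : ‖v‖ = 1) :
    MvPolynomial.eval (fun i => v i) f ≤ c := by
  obtain ⟨k, s, q, -, -, heq⟩ := h
  have h1 := congrArg (MvPolynomial.eval fun i => v i) heq
  have h2 : ∑ i, v i ^ 2 = 1 := by
    have := EuclideanSpace.norm_sq_eq v
    rw [hv] at this
    simpa using this.symm
  have h3 : 0 ≤ ∑ l, MvPolynomial.eval (fun i => v i) (s l) ^ 2 := by positivity
  simp only [map_sub, map_add, map_mul, map_sum, map_pow, MvPolynomial.eval_C, eval_normSqPoly, h2,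
    map_one, sub_self, zero_mul, add_zero] at h1
  linarith

theorem IsLambdaBounded.hasSoSCertificate {f : MvPolynomial (Fin n) ℝ} {lam : ℝ}
    (hf : IsLambdaBounded f lam) (hlam : 0 < lam) : HasSoSCertificate f lam := by
  obtain ⟨k, s, hs, heq⟩ := hf.exists_sum_sq hlam
  -- With `r = lam` and `u = ‖x‖²`, the multiplier comes from `u² + u - 2 = (u - 1) (u + 2)`.
  refine ⟨k, s, MvPolynomial.C (-(lam / 2)) * (normSqPoly n + MvPolynomial.C 2), hs, ?_, ?_⟩
  · refine (totalDegree_C_mul_le _ _).trans ((MvPolynomial.totalDegree_add _ _).trans ?_)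
    exact max_le (totalDegree_normSqPoly_le n) (by simp)
  · have h1 : lam ^ 2 / (2 * lam) = lam / 2 := by field_simp
    rw [h1] at heq
    rw [← heq]
    have h2 : (MvPolynomial.C lam : MvPolynomial (Fin n) ℝ) =
        MvPolynomial.C (lam / 2) * MvPolynomial.C 2 := by
      rw [← MvPolynomial.C_mul]; congr 1; ring
    have h3 : (MvPolynomial.C 2 : MvPolynomial (Fin n) ℝ) = 2 := map_ofNat _ 2
    rw [h2, h3, map_neg]
    ring

theorem IsLambdaBounded.soSCertifies {T : Fin n → Fin n → Fin n → ℝ} {lam : ℝ}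
    (hf : IsLambdaBounded (tensorPoly T) lam) (hlam : 0 < lam) : SoSCertifies T lam where
  certificate := hf.hasSoSCertificate hlam
  relaxation _ hL hsat := (hf.hasSoSCertificate hlam).pseudoExpectation_le hL hsat
  bound _ hv := (hf.hasSoSCertificate hlam).eval_le hv

/-- Nonnegativity on `(‖x‖² - t)²`, with `t` the pseudo-expectation of `‖x‖²`. -/
theorem IsPseudoExpectation.sq_le {L : PolyLE n 4 →ₗ[ℝ] ℝ} (hL : IsPseudoExpectation L) :
    L (normSqLE n) ^ 2 ≤ L (normFourLE n) := by
  set t := L (normSqLE n) with ht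
  have hdeg : (normSqPoly n - MvPolynomial.C t).totalDegree ≤ 2 :=
    (MvPolynomial.totalDegree_sub _ _).trans (max_le (totalDegree_normSqPoly_le n) (by simp))
  have h0 := hL.map_sq_nonneg ⟨_, sq_mem_polyLE hdeg⟩ _ hdeg rfl
  have h1 : (⟨_, sq_mem_polyLE hdeg⟩ : PolyLE n 4) = normFourLE n - (2 * t) • normSqLE n +
      t ^ 2 • (⟨1, one_mem_polyLE 4⟩ : PolyLE n 4) := by
    refine Subtype.ext ?_
    simp only [Submodule.coe_smul, Submodule.coe_add, Submodule.coe_sub, normFourLE, normSqLE]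
    rw [MvPolynomial.smul_eq_C_mul, MvPolynomial.smul_eq_C_mul, map_mul, map_pow]
    have h3 : (MvPolynomial.C 2 : MvPolynomial (Fin n) ℝ) = 2 := map_ofNat _ 2
    rw [h3]
    ring
  rw [h1, map_add, map_sub, map_smul, map_smul, hL.map_one ⟨1, one_mem_polyLE 4⟩ rfl, ← ht] at h0
  simp only [smul_eq_mul, mul_one] at h0
  linarith

/-- No sphere constraint is available, so `r` is adapted to the functional: with `u⁴` the value at
`‖x‖⁴`, the choice `r = lam * u` balances the two terms at `lam * u³ / 2` each. -/
theorem IsLambdaBounded.pseudoExpectation_le {T : Fin n → Fin n → Fin n → ℝ} {lam : ℝ}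
    (hf : IsLambdaBounded (tensorPoly T) lam) (hlam : 0 < lam) {L : PolyLE n 4 →ₗ[ℝ] ℝ}
    (hL : IsPseudoExpectation L) :
    L (tensorLE T) ≤ lam * L (normFourLE n) ^ (3 / 4 : ℝ) := by
  have hbound : ∀ r : ℝ, 0 < r → L (tensorLE T) ≤
      r / 2 * L (normSqLE n) + lam ^ 2 / (2 * r) * L (normFourLE n) := by
    intro r hr
    obtain ⟨k, s, hs, heq⟩ := hf.exists_sum_sq hr
    have h1 : (r / 2) • normSqLE n + (lam ^ 2 / (2 * r)) • normFourLE n = tensorLE T +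
        ∑ l, (⟨s l ^ 2, sq_mem_polyLE (hs l)⟩ : PolyLE n 4) := by
      refine Subtype.ext ?_
      simp only [Submodule.coe_smul, Submodule.coe_add, Submodule.coe_sum, normFourLE, normSqLE,
        tensorLE]
      rw [← heq, MvPolynomial.smul_eq_C_mul, MvPolynomial.smul_eq_C_mul]
      ring
    have h2 := congrArg L h1
    rw [map_add, map_add, map_smul, map_smul, map_sum] at h2
    have h3 : 0 ≤ ∑ l, L (⟨s l ^ 2, sq_mem_polyLE (hs l)⟩ : PolyLE n 4) :=
      Finset.sum_nonneg fun l _ => hL.map_sq_nonneg _ (s l) (hs l) rfl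
    simp only [smul_eq_mul] at h2
    linarith
  have hsq := hL.sq_le
  set a := L (normFourLE n) with ha
  set b := L (normSqLE n) with hb
  have ha0 : 0 ≤ a := (sq_nonneg b).trans hsq
  rcases ha0.eq_or_lt with h0 | hpos
  · have hb0 : b = 0 := by
      rw [← h0] at hsq
      exact pow_eq_zero_iff two_ne_zero |>.1 (le_antisymm hsq (sq_nonneg b))
    have := hbound 1 one_pos
    rw [hb0, ← h0] at this
    rw [← h0, Real.zero_rpow (by norm_num)]
    linarith
  · set u : ℝ := a ^ (1 / 4 : ℝ) with hu
    have hu0 : 0 < u := Real.rpow_pos_of_pos hpos _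
    have hu4 : u ^ 4 = a := by
      rw [hu, ← Real.rpow_natCast, ← Real.rpow_mul ha0]; norm_num
    have hu3 : a ^ (3 / 4 : ℝ) = u ^ 3 := by
      rw [hu, ← Real.rpow_natCast, ← Real.rpow_mul ha0]; norm_num
    have hbu : b ≤ u ^ 2 := by
      refine (le_abs_self _).trans (abs_le_of_sq_le_sq ?_ (sq_nonneg u))
      rw [← pow_mul, hu4]
      exact hsq
    have h1 := hbound (lam * u) (by positivity)
    have h2 : lam ^ 2 / (2 * (lam * u)) * a = lam / 2 * u ^ 3 := by
      rw [← hu4]; field_simp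
    have h3 : lam * u / 2 * b ≤ lam * u / 2 * u ^ 2 :=
      mul_le_mul_of_nonneg_left hbu (by positivity)
    rw [hu3]
    rw [h2] at h1
    linarith

end SumOfSquares

/-! ### The two entry laws are sub-Gaussian -/

section EntryLaws

theorem hasSubgaussianMGF_gaussianReal : HasSubgaussianMGF id 1 (gaussianReal 0 1) where
  integrable_exp_mul t := integrable_exp_mul_gaussianReal t
  mgf_le t := by
    rw [mgf_gaussianReal (by simp : (gaussianReal 0 1).map id = gaussianReal 0 1)]
    simp

instance isProbabilityMeasure_signLaw : IsProbabilityMeasure signLaw :=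
  ⟨by simp [signLaw, ENNReal.inv_two_add_inv_two]⟩

theorem hasSubgaussianMGF_signLaw : HasSubgaussianMGF id 1 signLaw := by
  -- Hoeffding's lemma: an interval of length `2` gives parameter `(2 / 2)² = 1`.
  have h := hasSubgaussianMGF_of_mem_Icc_of_integral_eq_zero (μ := signLaw) (X := id) (a := -1)
    (b := 1) aemeasurable_id ?_ ?_
  · convert! h using 1
    ext
    simp
    norm_num
  · have hset : MeasurableSet {x : ℝ | id x ∈ Set.Icc (-1 : ℝ) 1} := measurableSet_Icc
    simp only [signLaw, ae_add_measure_iff]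
    constructor <;> refine Measure.ae_smul_measure ?_ _ <;>
      (rw [ae_dirac_iff hset]; norm_num)
  · have hint : ∀ x : ℝ, Integrable id ((2⁻¹ : ENNReal) • Measure.dirac x) := fun x =>
      (integrable_dirac (by simp)).smul_measure (by simp)
    rw [signLaw, integral_add_measure (hint 1) (hint (-1))]
    simp

end EntryLaws

/-! ### Gaussian tensors -/

section GaussianTensor

variable {Ω : Type*} [MeasurableSpace Ω] {P : Measure Ω} {n : ℕ}
  {A : Fin n → Fin n → Fin n → Ω → ℝ}

theorem IsGaussianTensor.integral_mul (hA : IsGaussianTensor P A) (i j k j' k' : Fin n) :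
    ∫ ω, A i j k ω * A i j' k' ω ∂P = (if j = j' then 1 else 0) * (if k = k' then 1 else 0) := by
  have hmean : ∀ i j k, ∫ ω, A i j k ω ∂P = 0 := fun i j k => by
    rw [(hA.law i j k).integral_eq]
    exact integral_id_gaussianReal
  by_cases h : (j, k) = (j', k')
  · obtain ⟨rfl, rfl⟩ := Prod.mk.inj h
    have hv := (hA.law i j k).variance_eq
    rw [variance_eq_integral (hA.law i j k).aemeasurable, hmean, variance_id_gaussianReal] at hv
    simpa [sq] using hv
  · have hind : IndepFun (A i j k) (A i j' k') P :=
      hA.indep.indepFun (i := (i, j, k)) (j := (i, j', k')) (by simpa using h)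
    have hm := hind.integral_fun_mul_eq_mul_integral
      (hA.law i j k).aemeasurable.aestronglyMeasurable
      (hA.law i j' k').aemeasurable.aestronglyMeasurable
    rw [hm, hmean, zero_mul]
    by_cases h1 : j = j' <;> by_cases h2 : k = k' <;> simp_all

theorem IsGaussianTensor.expectMatrix_kronecker (hA : IsGaussianTensor P A) (i : Fin n) :
    expectMatrix P (fun ω => (Matrix.of fun j k => A i j k ω : Matrix (Fin n) (Fin n) ℝ) ⊗ₖ
      Matrix.of fun j k => A i j k ω) = vecIdMatrix n := by
  ext a b
  exact hA.integral_mul i a.1 b.1 a.2 b.2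

/-- The constant in the boundedness of random cubic forms. -/
noncomputable def boundednessConst : ℝ := √(deviationConst + 2)

theorem boundednessConst_pos : 0 < boundednessConst :=
  Real.sqrt_pos.2 (by linarith [deviationConst_pos])

theorem boundednessConst_mul_pos (hn : 2 ≤ n) :
    0 < boundednessConst * (n : ℝ) ^ (3 / 4 : ℝ) * Real.log n ^ (1 / 4 : ℝ) := by
  have h1 : (1 : ℝ) < n := by exact_mod_cast hn
  have := boundednessConst_pos
  have := Real.log_pos h1
  positivity

/-- For `n ≥ 2` one has `1 ≤ n log n`, so the cost `n` of absorbing the expectation is of lower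
order than the deviation. -/
theorem boundednessConst_mul_sq (hn : 2 ≤ n) :
    n + deviationConst * n * √n * √(Real.log n) ≤
      (boundednessConst * (n : ℝ) ^ (3 / 4 : ℝ) * Real.log n ^ (1 / 4 : ℝ)) ^ 2 := by
  have h2 : (2 : ℝ) ≤ n := by exact_mod_cast hn
  have hlog : Real.log 2 ≤ Real.log n := Real.log_le_log two_pos h2
  have hl2 := Real.log_two_gt_d9
  have hl0 : 0 ≤ Real.log n := by linarith
  have e1 : ((n : ℝ) ^ (3 / 4 : ℝ)) ^ 2 = n * √n := by
    rw [← Real.rpow_natCast, ← Real.rpow_mul (by positivity), Real.sqrt_eq_rpow]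
    nth_rw 2 [← Real.rpow_one (n : ℝ)]
    rw [← Real.rpow_add (by positivity)]
    norm_num
  have e2 : (Real.log n ^ (1 / 4 : ℝ)) ^ 2 = √(Real.log n) := by
    rw [← Real.rpow_natCast, ← Real.rpow_mul hl0, Real.sqrt_eq_rpow]
    norm_num
  rw [mul_pow, mul_pow, e1, e2, boundednessConst, Real.sq_sqrt (by linarith [deviationConst_pos])]
  have h1 : 1 ≤ √n * √(Real.log n) := by
    rw [← Real.sqrt_mul (by positivity), Real.one_le_sqrt]
    nlinarith
  nlinarith [mul_le_mul_of_nonneg_left h1 (by positivity : (0 : ℝ) ≤ n)]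

theorem IsGaussianTensor.prob_not_isLambdaBounded [IsProbabilityMeasure P]
    (hA : IsGaussianTensor P A) (hn : 2 ≤ n) :
    P {ω | ¬ IsLambdaBounded (tensorPoly fun i j k => A i j k ω)
        (boundednessConst * (n : ℝ) ^ (3 / 4 : ℝ) * Real.log n ^ (1 / 4 : ℝ))} ≤
      ENNReal.ofReal (8 * (n : ℝ) ^ (-10 : ℤ)) := by
  have : Nonempty (Fin n) := ⟨⟨0, by omega⟩⟩
  have hn1 : (1 : ℝ) ≤ n := by exact_mod_cast (by omega : 1 ≤ n)
  have htail := (isQuadraticMatrixMap_kronecker (m := Fin n)).prob_deviation_le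
    hasSubgaussianMGF_gaussianReal (by simpa using hn)
    (X := fun t ω => A t.1 t.2.1 t.2.2 ω) (fun t => hA.law _ _ _) hA.indep
  refine (measure_mono fun ω hω => ?_).trans (htail.trans (ENNReal.ofReal_le_ofReal ?_))
  · rw [Set.mem_ofPred_eq] at hω ⊢
    by_contra hcon
    refine hω (isLambdaBounded_of_norm_sub_le _ (boundednessConst_mul_pos hn) ?_)
    rw [not_lt] at hcon
    have hexp := fun i => hA.expectMatrix_kronecker i
    simp only [hexp, Fintype.card_fin, opNorm_eq_norm] at hcon
    exact (add_le_add_right hcon _).trans (boundednessConst_mul_sq hn)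
  · simp only [Fintype.card_fin, Fintype.card_prod]
    push_cast
    have h1 : (n : ℝ) * n * (n : ℝ) ^ (-102 : ℤ) = (n : ℝ) ^ (-100 : ℤ) := by
      have hn0 : (n : ℝ) ≠ 0 := by positivity
      rw [mul_assoc, ← zpow_one_add₀ hn0, ← zpow_one_add₀ hn0]
      norm_num
    rw [mul_assoc, h1]
    gcongr
    norm_num

end GaussianTensor

/-! ### The two Kronecker deviations together -/

section Deviation

variable {Ω : Type*} [MeasurableSpace Ω] {P : Measure Ω} [IsProbabilityMeasure P]

theorem measure_le_ofReal_of_eq_one {n : ℕ} (hn : n = 1) {K : ℝ} (hK : 1 ≤ K) (z : ℤ)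
    (s : Set Ω) : P s ≤ ENNReal.ofReal (K * (n : ℝ) ^ z) := by
  subst hn
  refine prob_le_one.trans ?_
  simpa using hK

theorem prob_kroneckerDeviation_le {k N : ℕ} (hN : 2 ≤ N) {ν : Measure ℝ}
    [IsProbabilityMeasure ν] (hν : HasSubgaussianMGF id 1 ν)
    {A : Fin k → Ω → Matrix (Fin N) (Fin N) ℝ}
    (hlaw : ∀ i j l, HasLaw (fun ω => A i ω j l) ν P)
    (hind : iIndepFun (fun (t : Fin k × Fin N × Fin N) (ω : Ω) => A t.1 ω t.2.1 t.2.2) P) :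
    P {ω | ¬ (opNorm (kroneckerDeviation P A ω) ≤
            deviationConst * N * √(k : ℝ) * √(Real.log N) ∧
          opNorm (kroneckerTransposeDeviation P A ω) ≤
            deviationConst * N * √(k : ℝ) * √(Real.log N))} ≤
      ENNReal.ofReal (16 * (N : ℝ) ^ (-100 : ℤ)) := by
  have : Nonempty (Fin N) := ⟨⟨0, by omega⟩⟩
  have h1 := (isQuadraticMatrixMap_kronecker (m := Fin N)).prob_deviation_le hν
    (by simpa using hN) (X := fun t ω => A t.1 ω t.2.1 t.2.2) (fun t => hlaw _ _ _) hind
  have h2 := (isQuadraticMatrixMap_kronecker_transpose (m := Fin N)).prob_deviation_le hν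
    (by simpa using hN) (X := fun t ω => A t.1 ω t.2.1 t.2.2) (fun t => hlaw _ _ _) hind
  have hN0 : (N : ℝ) ≠ 0 := by positivity
  have hpow : 8 * ((N : ℝ) * N) * (N : ℝ) ^ (-102 : ℤ) = 8 * (N : ℝ) ^ (-100 : ℤ) := by
    rw [mul_assoc, mul_assoc (N : ℝ), ← zpow_one_add₀ hN0, ← zpow_one_add₀ hN0]
    norm_num
  simp only [Fintype.card_fin, Fintype.card_prod, Nat.cast_mul, hpow] at h1 h2
  have hsplit : ENNReal.ofReal (16 * (N : ℝ) ^ (-100 : ℤ)) =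
      ENNReal.ofReal (8 * (N : ℝ) ^ (-100 : ℤ)) + ENNReal.ofReal (8 * (N : ℝ) ^ (-100 : ℤ)) := by
    rw [← ENNReal.ofReal_add (by positivity) (by positivity)]
    congr 1; ring
  rw [hsplit]
  refine le_trans (measure_mono fun ω hω => ?_) ((measure_union_le _ _).trans (add_le_add h1 h2))
  rw [Set.mem_ofPred_eq, not_and_or, not_le, not_le] at hω
  exact hω

/-- The factor `√d` is the price of `log (n ^ d) = d log n`. -/
theorem deviation_bound_pow (n d c : ℕ) :
    deviationConst * ((n ^ d : ℕ) : ℝ) * √((n ^ c : ℕ) : ℝ) * √(Real.log ((n ^ d : ℕ) : ℝ)) =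
      deviationConst * √(d : ℝ) * (n : ℝ) ^ ((2 * (d : ℝ) + (c : ℝ)) / 2) * √(Real.log n) := by
  have h1 : √(Real.log ((n ^ d : ℕ) : ℝ)) = √(d : ℝ) * √(Real.log n) := by
    rw [Nat.cast_pow, Real.log_pow, Real.sqrt_mul (Nat.cast_nonneg _)]
  have h2 : (n : ℝ) ^ ((2 * (d : ℝ) + (c : ℝ)) / 2) =
      ((n ^ d : ℕ) : ℝ) * √((n ^ c : ℕ) : ℝ) := by
    rw [Real.sqrt_eq_rpow, Nat.cast_pow, Nat.cast_pow, ← Real.rpow_natCast, ← Real.rpow_natCast,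
      ← Real.rpow_mul (Nat.cast_nonneg _),
      ← Real.rpow_add_of_nonneg (Nat.cast_nonneg _) (by positivity) (by positivity)]
    congr 1; ring
  rw [h1, h2]
  ring

end Deviation

end TensorSoS

/-! ### The main theorem -/

theorem mainTheorem7 :
    -- Concentration of `∑ Aᵢ ⊗ Aᵢ` and `∑ Aᵢ ⊗ Aᵢᵀ`, with absolute constants.
    (∃ C K : ℝ, 0 < C ∧ 0 < K ∧ ∀ (n d c : ℕ), 1 ≤ n → 1 ≤ d → (c = 1 ∨ c = 2) →
      ∀ (ν : Measure ℝ), (ν = gaussianReal 0 1 ∨ ν = signLaw) →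
      ∀ (Ω : Type*) [MeasurableSpace Ω] (P : Measure Ω) [IsProbabilityMeasure P]
        (A : Fin (n ^ c) → Ω → Matrix (Fin (n ^ d)) (Fin (n ^ d)) ℝ),
        (∀ i j k, HasLaw (fun ω => A i ω j k) ν P) →
        iIndepFun (fun (t : Fin (n ^ c) × Fin (n ^ d) × Fin (n ^ d)) (ω : Ω) =>
          A t.1 ω t.2.1 t.2.2) P →
        P {ω | ¬ (opNorm (kroneckerDeviation P A ω) ≤
                C * √(d : ℝ) * (n : ℝ) ^ ((2 * (d : ℝ) + (c : ℝ)) / 2) * √(Real.log n) ∧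
              opNorm (kroneckerTransposeDeviation P A ω) ≤
                C * √(d : ℝ) * (n : ℝ) ^ ((2 * (d : ℝ) + (c : ℝ)) / 2) * √(Real.log n))}
          ≤ ENNReal.ofReal (K * (n : ℝ) ^ (-100 : ℤ))) ∧
    -- With high probability `A(x)` is `λ`-bounded.
    (∃ C K : ℝ, 0 < C ∧ 0 < K ∧ ∀ (n : ℕ), 1 ≤ n →
      ∀ (Ω : Type*) [MeasurableSpace Ω] (P : Measure Ω) [IsProbabilityMeasure P]
        (A : Fin n → Fin n → Fin n → Ω → ℝ), IsGaussianTensor P A →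
        P {ω | ¬ IsLambdaBounded (tensorPoly fun i j k => A i j k ω)
              (C * (n : ℝ) ^ (3 / 4 : ℝ) * Real.log n ^ (1 / 4 : ℝ))}
          ≤ ENNReal.ofReal (K * (n : ℝ) ^ (-10 : ℤ))) ∧
    -- With high probability degree-`4` SoS certifies the bound on the unit sphere, and every
    -- degree-`4` pseudo-expectation satisfies the homogeneous bound.
    (∃ C K : ℝ, 0 < C ∧ 0 < K ∧ ∀ (n : ℕ), 1 ≤ n →
      ∀ (Ω : Type*) [MeasurableSpace Ω] (P : Measure Ω) [IsProbabilityMeasure P]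
        (A : Fin n → Fin n → Fin n → Ω → ℝ), IsGaussianTensor P A →
        P {ω | ¬ (SoSCertifies (fun i j k => A i j k ω)
                (C * (n : ℝ) ^ (3 / 4 : ℝ) * Real.log n ^ (1 / 4 : ℝ)) ∧
              ∀ L : PolyLE n 4 →ₗ[ℝ] ℝ, IsPseudoExpectation L →
                L (tensorLE fun i j k => A i j k ω) ≤
                  (C * (n : ℝ) ^ (3 / 4 : ℝ) * Real.log n ^ (1 / 4 : ℝ)) *
                    L (normFourLE n) ^ (3 / 4 : ℝ))}
          ≤ ENNReal.ofReal (K * (n : ℝ) ^ (-10 : ℤ))) := by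
  refine ⟨⟨deviationConst, 16, deviationConst_pos, by norm_num, ?_⟩,
    ⟨boundednessConst, 8, boundednessConst_pos, by norm_num, ?_⟩,
    ⟨boundednessConst, 8, boundednessConst_pos, by norm_num, ?_⟩⟩
  · intro n d c hn hd _ ν hν Ω _ P _ A hlaw hind
    -- For `n = 1` the logarithm vanishes, but the allowed failure probability is `K ≥ 1`, so
    -- nothing is claimed.
    rcases hn.eq_or_lt with h1 | h2
    · exact measure_le_ofReal_of_eq_one h1.symm (by norm_num) _ _
    obtain ⟨_, hsub⟩ : IsProbabilityMeasure ν ∧ HasSubgaussianMGF id 1 ν := by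
      rcases hν with rfl | rfl
      · exact ⟨inferInstance, hasSubgaussianMGF_gaussianReal⟩
      · exact ⟨inferInstance, hasSubgaussianMGF_signLaw⟩
    have hnd : n ≤ n ^ d := Nat.le_self_pow (by omega) n
    have h := prob_kroneckerDeviation_le (k := n ^ c) (h2.trans_le hnd) hsub hlaw hind
    rw [deviation_bound_pow] at h
    refine h.trans (ENNReal.ofReal_le_ofReal ?_)
    refine mul_le_mul_of_nonneg_left ?_ (by norm_num)
    rw [zpow_neg, zpow_neg]
    have hn0 : (0 : ℝ) < n := by exact_mod_cast hn
    have hnd' : (n : ℝ) ≤ ((n ^ d : ℕ) : ℝ) := by exact_mod_cast hnd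
    gcongr
    exact_mod_cast pow_le_pow_left₀ hn0.le hnd' 100
  · intro n hn Ω _ P _ A hA
    rcases hn.eq_or_lt with h1 | h2
    · exact measure_le_ofReal_of_eq_one h1.symm (by norm_num) _ _
    exact hA.prob_not_isLambdaBounded h2
  · intro n hn Ω _ P _ A hA
    rcases hn.eq_or_lt with h1 | h2
    · exact measure_le_ofReal_of_eq_one h1.symm (by norm_num) _ _
    have hpos := boundednessConst_mul_pos h2
    -- Both conclusions follow deterministically from boundedness, so they fail only on the event
    -- already estimated.
    refine (measure_mono ?_).trans (hA.prob_not_isLambdaBounded h2)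
    exact fun ω hω hb =>
      hω ⟨hb.soSCertifies hpos, fun L hL => hb.pseudoExpectation_le hpos hL⟩
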